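/- Let $n\ge 1$ and let $(M,\omega)$ be an $n$-plectic manifold: $M$ is a smooth manifold and $\omega\in\Omega^{n+1}(M)$ is a closed form such that $v\mapsto v\lrcorner\omega$ is injective on every tangent space $T_xM$. Let $G$ be a connected Lie group with Lie algebra $\mathfrak g$ that acts smoothly on $M$ and multisymplectically, i.e. $\Phi_g^*\omega=\omega$ for all $g\in G$, where $\Phi_g(x)=g\cdot x$. *Notation.* For $\xi\in\mathfrak g$ let $V_\xi$ be the infinitesimal generator, $V_\xi(x)=\frac{d}{dt}\big|_{t=0}\exp(t\xi)\cdot x$; for $p=\xi_1\wedge\dots\wedge\xi_k$ put $V_p=V_{\xi_1}\wedge\dots\wedge V_{\xi_k}$ and extend linearly to $p\in\Lambda^k\mathfrak g$. For a $k$-vector field, $(X_1\wedge\dots\wedge X_k)\lrcorner\tau=\tau(X_1,\dots,X_k,\cdot,\dots,\cdot)$, extended linearly. The $k$-th Lie kernel $\mathcal P_{\mathfrak g,k}\subset\Lambda^k\mathfrak g$ is the kernel of $$\partial_k(\xi_1\wedge\dots\wedge\xi_k)=\sum_{i<j}(-1)^{i+j}[\xi_i,\xi_j]\wedge\xi_1\wedge\dots\wedge\widehat{\xi_i}\wedge\dots\wedge\widehat{\xi_j}\wedge\dots\wedge\xi_k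 .$$ It is invariant under the adjoint action $\mathrm{ad}_\xi(\eta_1\wedge\dots\wedge\eta_k)=\sum_i\eta_1\wedge\dots\wedge[\xi,\eta_i]\wedge\dots\wedge\eta_k$. The Lie algebra $\mathfrak g$ acts on $\mathcal P_{\mathfrak g,k}^*$ by $(\xi\cdot c)(p)=-c(\mathrm{ad}_\xi p)$, on the space $\Omega^{m}_{\mathrm{cl}}$ of closed $m$-forms on $M$ by $\xi\cdot\alpha=-\mathcal L_{V_\xi}\alpha$, and on $\mathcal P_{\mathfrak g,k}^*\otimes\Omega^{m}_{\mathrm{cl}}$ by the tensor product of these actions. For a $\mathfrak g$-module $R$, $H^0(\mathfrak g,R)=\{r\in R:\ \xi\cdot r=0\text{ for all }\xi\in\mathfrak g\}$. For $1\le k\le n$ let $\Omega^{n-k}_{\mathrm{Ham}}(M)$ be the set of $\alpha\in\Omega^{n-k}(M)$ for which there is a smooth $k$-vector field $X$ with $d\alpha=-X\lrcorner\omega$. A (not necessarily equivariant) weak $k$-moment map is a linear map $f_k:\mathcal P_{\mathfrak g,k}\to\Omega^{n-k}_{\mathrm{Ham}}(M)$ with $$d f_k(p)=-\zeta(k)\,V_p\lrcorner\omega\quad\text{for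 all }p\in\mathcal P_{\mathfrak g,k},\qquad \zeta(k)=-(-1)^{k(k+1)/2}.$$ A (not necessarily equivariant) full weak moment map is a collection of weak $k$-moment maps $f_k$, one for each $1\le k\le n$. *Theorem.* 1. If $1\le k\le n$ and $H^0(\mathfrak g,\mathcal P_{\mathfrak g,k}^*)=0$, then a weak $k$-moment map exists. If $H^0(\mathfrak g,\mathcal P_{\mathfrak g,k}^*)=0$ for all $1\le k\le n$, then a full weak moment map exists. 2. If $1\le k\le n$, $H^0(\mathfrak g,\mathcal P_{\mathfrak g,k}^*\otimes\Omega^{n-k}_{\mathrm{cl}})=0$ and $H^0(\mathfrak g,\Omega^{n-k}_{\mathrm{cl}})\neq 0$, then a weak $k$-moment map exists. If these two conditions hold for all $1\le k\le n$, then a full weak moment map exists. -/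

import Mathlib

open scoped Manifold ContDiff
noncomputable section
namespace Multisymplectic

section Algebra
variable {L : Type*} [LieRing L] [LieAlgebra ℝ L]

theorem exteriorAlgebra_left_induction {P : ExteriorAlgebra ℝ L → Prop}
    (algebraMap : ∀ r : ℝ, P (algebraMap ℝ (ExteriorAlgebra ℝ L) r))
    (add : ∀ x y, P x → P y → P (x + y))
    (ι_mul : ∀ x m, P x → P (ExteriorAlgebra.ι ℝ m * x)) (x : ExteriorAlgebra ℝ L) : P x :=
  CliffordAlgebra.left_induction (0 : QuadraticForm ℝ L) algebraMap add ι_mul x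

/-- The derivation of the exterior algebra of `L` that extends `η ↦ ⁅ξ, η⁆`, defined by the
recursion `adExtAux_one`, `adExtAux_ι_mul`. -/
def adExtAux (ξ : L) : ExteriorAlgebra ℝ L →ₗ[ℝ] ExteriorAlgebra ℝ L :=
  CliffordAlgebra.foldr' (0 : QuadraticForm ℝ L)
    (LinearMap.mk₂ ℝ
      (fun (η : L) (z : ExteriorAlgebra ℝ L × ExteriorAlgebra ℝ L) =>
        ExteriorAlgebra.ι ℝ ⁅ξ, η⁆ * z.1 + ExteriorAlgebra.ι ℝ η * z.2)
      (by intro a b z; simp only [lie_add, map_add, add_mul]; abel)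
      (by intro c a z; simp)
      (by intro a z w; simp only [Prod.fst_add, Prod.snd_add, mul_add]; abel)
      (by intro c a z; simp))
    (by
      intro m x y
      have h1 : ExteriorAlgebra.ι ℝ m * (ExteriorAlgebra.ι ℝ m * y) = 0 := by
        rw [← mul_assoc, ExteriorAlgebra.ι_sq_zero, zero_mul]
      have h2 : ExteriorAlgebra.ι ℝ ⁅ξ, m⁆ * (ExteriorAlgebra.ι ℝ m * x) +
          ExteriorAlgebra.ι ℝ m * (ExteriorAlgebra.ι ℝ ⁅ξ, m⁆ * x) = 0 := by
        rw [← mul_assoc, ← mul_assoc, ← add_mul, ExteriorAlgebra.ι_add_mul_swap, zero_mul]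
      simp only [LinearMap.mk₂_apply, mul_add, h1, add_zero, _root_.zero_apply, zero_smul]
      exact h2)
    0

theorem adExtAux_algebraMap (ξ : L) (r : ℝ) :
    adExtAux ξ (algebraMap ℝ (ExteriorAlgebra ℝ L) r) = 0 :=
  (CliffordAlgebra.foldr'_algebraMap (0 : QuadraticForm ℝ L) _ _ _ r).trans (smul_zero _)

theorem adExtAux_ι_mul (ξ η : L) (x : ExteriorAlgebra ℝ L) :
    adExtAux ξ (ExteriorAlgebra.ι ℝ η * x) =
      ExteriorAlgebra.ι ℝ ⁅ξ, η⁆ * x + ExteriorAlgebra.ι ℝ η * adExtAux ξ x :=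
  CliffordAlgebra.foldr'_ι_mul _ _ _ _ _ _

/-- The extended adjoint action of `L` on its exterior algebra,
`ad_ξ (η₁ ∧ ⋯ ∧ ηₖ) = ∑ᵢ η₁ ∧ ⋯ ∧ ⁅ξ, ηᵢ⁆ ∧ ⋯ ∧ ηₖ` (see `adExt_ιMulti`). -/
def adExt : L →ₗ[ℝ] ExteriorAlgebra ℝ L →ₗ[ℝ] ExteriorAlgebra ℝ L where
  toFun := adExtAux
  map_add' a b := by
    refine LinearMap.ext fun x => ?_
    induction x using exteriorAlgebra_left_induction with
    | algebraMap r => simp only [LinearMap.add_apply, adExtAux_algebraMap, add_zero]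
    | add x y hx hy => simp only [map_add, hx, hy]
    | ι_mul x m hx =>
      simp only [LinearMap.add_apply] at hx ⊢
      simp only [adExtAux_ι_mul, hx, add_lie, map_add, add_mul, mul_add]
      abel
  map_smul' c a := by
    refine LinearMap.ext fun x => ?_
    induction x using exteriorAlgebra_left_induction with
    | algebraMap r =>
      simp only [LinearMap.smul_apply, RingHom.id_apply, adExtAux_algebraMap, smul_zero]
    | add x y hx hy => simp only [map_add, hx, hy]
    | ι_mul x m hx =>
      simp only [LinearMap.smul_apply, RingHom.id_apply] at hx ⊢
      simp only [adExtAux_ι_mul, hx, smul_lie, map_smul, smul_mul_assoc, mul_smul_comm, smul_add]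

theorem adExt_algebraMap (ξ : L) (r : ℝ) :
    adExt ξ (algebraMap ℝ (ExteriorAlgebra ℝ L) r) = 0 :=
  adExtAux_algebraMap ξ r

theorem adExt_ι_mul (ξ η : L) (x : ExteriorAlgebra ℝ L) :
    adExt ξ (ExteriorAlgebra.ι ℝ η * x) =
      ExteriorAlgebra.ι ℝ ⁅ξ, η⁆ * x + ExteriorAlgebra.ι ℝ η * adExt ξ x :=
  adExtAux_ι_mul ξ η x

/-- The Chevalley–Eilenberg differential of the exterior algebra of `L`, defined by the recursion
`∂ 1 = 0`, `∂ (η ∧ x) = - η ∧ ∂ x - ad_η x`. On decomposable elements it is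
`∂ (ξ₁ ∧ ⋯ ∧ ξₖ) = ∑_{i<j} (-1)^{i+j} ⁅ξᵢ, ξⱼ⁆ ∧ ξ₁ ∧ ⋯ ∧ ξ̂ᵢ ∧ ⋯ ∧ ξ̂ⱼ ∧ ⋯ ∧ ξₖ`
(see `ceDiff_ιMulti`). -/
def ceDiff : ExteriorAlgebra ℝ L →ₗ[ℝ] ExteriorAlgebra ℝ L :=
  CliffordAlgebra.foldr' (0 : QuadraticForm ℝ L)
    (LinearMap.mk₂ ℝ
      (fun (η : L) (z : ExteriorAlgebra ℝ L × ExteriorAlgebra ℝ L) =>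
        -(ExteriorAlgebra.ι ℝ η * z.2) - adExt η z.1)
      (by intro a b z; simp only [map_add, add_mul, LinearMap.add_apply]; abel)
      (by intro c a z; simp [smul_sub])
      (by intro a z w; simp only [Prod.fst_add, Prod.snd_add, mul_add, map_add]; abel)
      (by intro c a z; simp [smul_sub]))
    (by
      intro m x y
      have h1 : ExteriorAlgebra.ι ℝ m * (ExteriorAlgebra.ι ℝ m * y) = 0 := by
        rw [← mul_assoc, ExteriorAlgebra.ι_sq_zero, zero_mul]
      have h2 := adExt_ι_mul m m x
      rw [lie_self, map_zero, zero_mul, zero_add] at h2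
      simp only [LinearMap.mk₂_apply, mul_sub, mul_neg, h1, _root_.zero_apply, zero_smul]
      erw [h2]
      simp)
    0

theorem ceDiff_algebraMap (r : ℝ) :
    ceDiff (algebraMap ℝ (ExteriorAlgebra ℝ L) r) = 0 :=
  (CliffordAlgebra.foldr'_algebraMap (0 : QuadraticForm ℝ L) _ _ _ r).trans (smul_zero _)

theorem ceDiff_ι_mul (η : L) (x : ExteriorAlgebra ℝ L) :
    ceDiff (ExteriorAlgebra.ι ℝ η * x) = -(ExteriorAlgebra.ι ℝ η * ceDiff x) - adExt η x :=
  CliffordAlgebra.foldr'_ι_mul _ _ _ _ _ _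

theorem adExt_lie (ξ η : L) (x : ExteriorAlgebra ℝ L) :
    adExt ⁅ξ, η⁆ x = adExt ξ (adExt η x) - adExt η (adExt ξ x) := by
  induction x using exteriorAlgebra_left_induction with
  | algebraMap r => simp only [adExt_algebraMap, map_zero, sub_zero]
  | add x y hx hy => simp only [map_add, hx, hy]; abel
  | ι_mul x m hx =>
    simp only [adExt_ι_mul, map_add, hx, lie_lie, map_sub, sub_mul, mul_sub]
    abel

theorem ceDiff_adExt (ξ : L) (x : ExteriorAlgebra ℝ L) :
    ceDiff (adExt ξ x) = adExt ξ (ceDiff x) := by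
  induction x using exteriorAlgebra_left_induction with
  | algebraMap r => simp only [adExt_algebraMap, ceDiff_algebraMap, map_zero]
  | add x y hx hy => simp only [map_add, hx, hy]
  | ι_mul x m hx =>
    simp only [adExt_ι_mul, ceDiff_ι_mul, map_add, map_sub, map_neg, hx, adExt_lie]
    abel

/-- The extended adjoint action on decomposable elements. -/
theorem adExt_ιMulti (ξ : L) (k : ℕ) (v : Fin k → L) :
    adExt ξ (ExteriorAlgebra.ιMulti ℝ k v) =
      ∑ i, ExteriorAlgebra.ιMulti ℝ k (Function.update v i ⁅ξ, v i⁆) := by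
  induction k with
  | zero => simpa using! adExt_algebraMap ξ 1
  | succ k ih =>
    rw [ExteriorAlgebra.ιMulti_succ_apply, adExt_ι_mul, ih, Fin.sum_univ_succ, Finset.mul_sum]
    congr 1
    · rw [ExteriorAlgebra.ιMulti_succ_apply]
      simp [Matrix.vecTail, Function.comp_def]
    · refine Finset.sum_congr rfl fun i _ => ?_
      rw [ExteriorAlgebra.ιMulti_succ_apply, Function.update_of_ne (Fin.succ_ne_zero i).symm]
      congr 2
      ext j
      by_cases h : j = i
      · subst h; simp [Matrix.vecTail]
      · simp [Matrix.vecTail, h]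

theorem ι_mul_ι_mul_swap (a b : L) (x : ExteriorAlgebra ℝ L) :
    ExteriorAlgebra.ι ℝ a * (ExteriorAlgebra.ι ℝ b * x) =
      -(ExteriorAlgebra.ι ℝ b * (ExteriorAlgebra.ι ℝ a * x)) := by
  rw [← mul_assoc, ← mul_assoc, ← neg_mul,
    eq_neg_of_add_eq_zero_left (ExteriorAlgebra.ι_add_mul_swap (R := ℝ) a b)]

theorem ιMulti_removeNth_succ (k : ℕ) (v : Fin (k + 2) → L) (i : Fin (k + 1)) :
    ExteriorAlgebra.ιMulti ℝ (k + 1) (i.succ.removeNth v) =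
      ExteriorAlgebra.ι ℝ (v 0) *
        ExteriorAlgebra.ιMulti ℝ k (i.removeNth (Matrix.vecTail v)) := by
  rw [ExteriorAlgebra.ιMulti_succ_apply]
  congr 3
  ext j
  simp [Fin.removeNth, Matrix.vecTail]

theorem adExt_ιMulti' (ξ : L) (k : ℕ) (v : Fin (k + 1) → L) :
    adExt ξ (ExteriorAlgebra.ιMulti ℝ (k + 1) v) =
      ∑ i : Fin (k + 1), (-1 : ℝ) ^ (i : ℕ) •
        (ExteriorAlgebra.ι ℝ ⁅ξ, v i⁆ * ExteriorAlgebra.ιMulti ℝ k (i.removeNth v)) := by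
  induction k with
  | zero =>
    rw [ExteriorAlgebra.ιMulti_succ_apply, adExt_ι_mul]
    have : adExt ξ (1 : ExteriorAlgebra ℝ L) = 0 := by simpa using! adExt_algebraMap ξ 1
    simp [this]
  | succ k ih =>
    rw [ExteriorAlgebra.ιMulti_succ_apply, adExt_ι_mul, ih, Finset.mul_sum, Fin.sum_univ_succ
      (fun i : Fin (k + 1 + 1) => (-1 : ℝ) ^ (i : ℕ) •
        (ExteriorAlgebra.ι ℝ ⁅ξ, v i⁆ * ExteriorAlgebra.ιMulti ℝ (k + 1) (i.removeNth v)))]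
    congr 1
    · simp only [Fin.val_zero, pow_zero, one_smul, Fin.removeNth_zero]
      rfl
    · refine Finset.sum_congr rfl fun i _ => ?_
      rw [ιMulti_removeNth_succ, ι_mul_ι_mul_swap, Fin.val_succ, pow_succ, mul_neg_one, neg_smul,
        smul_neg, neg_neg, mul_smul_comm]
      rfl

/-- The Chevalley–Eilenberg differential on decomposable elements; the indices `i ≤ j` stand for
the positions `i` and `j + 1` of the two omitted factors, counted from `0`. -/
theorem ceDiff_ιMulti (k : ℕ) (v : Fin (k + 2) → L) :
    ceDiff (ExteriorAlgebra.ιMulti ℝ (k + 2) v) =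
      ∑ i : Fin (k + 1), ∑ j ≥ i, (-1 : ℝ) ^ (i + j + 1 : ℕ) •
        (ExteriorAlgebra.ι ℝ ⁅v i.castSucc, v j.succ⁆ *
          ExteriorAlgebra.ιMulti ℝ k (j.removeNth (i.castSucc.removeNth v))) := by
  induction k with
  | zero =>
    have h1 (η : L) : ceDiff (ExteriorAlgebra.ι ℝ η) = 0 := by
      have := ceDiff_ι_mul η (algebraMap ℝ (ExteriorAlgebra ℝ L) 1)
      rwa [ceDiff_algebraMap, adExt_algebraMap, map_one, mul_one, mul_zero, neg_zero,
        sub_zero] at this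
    have h2 (ξ η : L) : adExt ξ (ExteriorAlgebra.ι ℝ η) = ExteriorAlgebra.ι ℝ ⁅ξ, η⁆ := by
      have := adExt_ι_mul ξ η (algebraMap ℝ (ExteriorAlgebra ℝ L) 1)
      rwa [adExt_algebraMap, map_one, mul_one, mul_one, mul_zero, add_zero] at this
    rw [ExteriorAlgebra.ιMulti_succ_apply, ExteriorAlgebra.ιMulti_succ_apply]
    simp [ceDiff_ι_mul, h1, h2, Matrix.vecTail]
  | succ k ih =>
    rw [ExteriorAlgebra.ιMulti_succ_apply, ceDiff_ι_mul, adExt_ιMulti', ih, Finset.mul_sum,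
      Fin.sum_univ_succ (fun i : Fin (k + 1 + 1) => ∑ j ≥ i, (-1 : ℝ) ^ (i + j + 1 : ℕ) •
        (ExteriorAlgebra.ι ℝ ⁅v i.castSucc, v j.succ⁆ *
          ExteriorAlgebra.ιMulti ℝ (k + 1) (j.removeNth (i.castSucc.removeNth v)))),
      sub_eq_add_neg, add_comm, ← Finset.sum_neg_distrib, ← Finset.sum_neg_distrib]
    congr 1
    · refine Finset.sum_congr (by ext; simp) fun j _ => ?_
      simp only [Fin.castSucc_zero, Fin.removeNth_zero, Fin.val_zero, zero_add, pow_succ, mul_neg,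
        mul_one, neg_smul]
      rfl
    · refine Finset.sum_congr rfl fun i _ => ?_
      have hI : Finset.Ici i.succ = (Finset.Ici i).map (Fin.succEmb (k + 1)) := by
        simp
      rw [hI, Finset.sum_map, Finset.mul_sum, ← Finset.sum_neg_distrib]
      refine Finset.sum_congr rfl fun j _ => ?_
      have h : ExteriorAlgebra.ιMulti ℝ (k + 1)
          (j.succ.removeNth (i.succ.castSucc.removeNth v)) = ExteriorAlgebra.ι ℝ (v 0) *
            ExteriorAlgebra.ιMulti ℝ k (j.removeNth (i.castSucc.removeNth (Matrix.vecTail v))) := by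
        rw [ιMulti_removeNth_succ]
        congr 3
        ext l
        simp [Fin.removeNth, Matrix.vecTail]
      simp only [Fin.coe_succEmb]
      rw [h, ι_mul_ι_mul_swap, Fin.val_succ, Fin.val_succ, mul_smul_comm, smul_neg]
      have hs : (-1 : ℝ) ^ ((i : ℕ) + 1 + (j + 1) + 1) = (-1) ^ ((i : ℕ) + j + 1) := by ring
      rw [hs]
      rfl

theorem adExt_mem (ξ : L) (k : ℕ) {x : ExteriorAlgebra ℝ L} (hx : x ∈ ⋀[ℝ]^k L) :
    adExt ξ x ∈ ⋀[ℝ]^k L := by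
  rw [← ExteriorAlgebra.ιMulti_span_fixedDegree] at hx ⊢
  induction hx using Submodule.span_induction with
  | mem x h =>
    obtain ⟨v, rfl⟩ := h
    rw [adExt_ιMulti]
    exact Submodule.sum_mem _ fun i _ => Submodule.subset_span ⟨_, rfl⟩
  | zero => rw [map_zero]; exact Submodule.zero_mem _
  | add x y _ _ hx hy => rw [map_add]; exact Submodule.add_mem _ hx hy
  | smul c x _ hx => rw [map_smul]; exact Submodule.smul_mem _ c hx

variable (L) in
/-- The `k`-th Lie kernel `P_{L,k}`: the kernel of the Chevalley–Eilenberg differential on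
`Λ^k L`. -/
def lieKernel (k : ℕ) : Submodule ℝ (⋀[ℝ]^k L) :=
  LinearMap.ker (ceDiff ∘ₗ (⋀[ℝ]^k L).subtype)

/-- The adjoint action of `L` on its `k`-th Lie kernel. -/
def adKernel (k : ℕ) : L →ₗ[ℝ] Module.End ℝ (lieKernel L k) where
  toFun ξ :=
    { toFun := fun p => ⟨⟨adExt ξ p, adExt_mem ξ k p.1.2⟩, by
        have hp : ceDiff (p : ExteriorAlgebra ℝ L) = 0 := p.2
        change ceDiff (adExt ξ (p : ExteriorAlgebra ℝ L)) = 0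
        rw [ceDiff_adExt, hp, map_zero]⟩
      map_add' := fun p q => Subtype.ext (Subtype.ext (map_add (adExt ξ) _ _))
      map_smul' := fun c p => Subtype.ext (Subtype.ext (map_smul (adExt ξ) c _)) }
  map_add' ξ η := LinearMap.ext fun p => Subtype.ext (Subtype.ext
    (LinearMap.congr_fun (map_add adExt ξ η) (p : ExteriorAlgebra ℝ L)))
  map_smul' c ξ := LinearMap.ext fun p => Subtype.ext (Subtype.ext
    (LinearMap.congr_fun (map_smul adExt c ξ) (p : ExteriorAlgebra ℝ L)))

/-- The coadjoint action on the dual of the Lie kernel, `(ξ · c)(p) = -c(ad_ξ p)`. -/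
def coadKernel (k : ℕ) : L →ₗ[ℝ] Module.End ℝ (Module.Dual ℝ (lieKernel L k)) where
  toFun ξ := -(adKernel k ξ).dualMap
  map_add' ξ η := by
    refine LinearMap.ext fun c => LinearMap.ext fun p => ?_
    change -c (adKernel k (ξ + η) p) = -c (adKernel k ξ p) + -c (adKernel k η p)
    rw [map_add, LinearMap.add_apply, map_add, neg_add]
  map_smul' r ξ := by
    refine LinearMap.ext fun c => LinearMap.ext fun p => ?_
    change -c (adKernel k (r • ξ) p) = r • -c (adKernel k ξ p)
    rw [map_smul, LinearMap.smul_apply, map_smul, smul_neg]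

/-- The action on a tensor product, `ξ · (r ⊗ s) = (ξ · r) ⊗ s + r ⊗ (ξ · s)`. -/
def tensorAction {R S : Type*} [AddCommGroup R] [Module ℝ R] [AddCommGroup S] [Module ℝ S]
    (ρ : L →ₗ[ℝ] Module.End ℝ R) (σ : L →ₗ[ℝ] Module.End ℝ S) :
    L →ₗ[ℝ] Module.End ℝ (TensorProduct ℝ R S) :=
  LinearMap.rTensorHom S ∘ₗ ρ + LinearMap.lTensorHom R ∘ₗ σ

/-- `H⁰(L, R)` for the action `ρ` of `L` on `R`: the kernel of `δ₀ : R → C¹(L, R)`,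
`(δ₀ r)(ξ) = ξ · r`. -/
def lieH0 {R : Type*} [AddCommGroup R] [Module ℝ R] (ρ : L →ₗ[ℝ] Module.End ℝ R) :
    Submodule ℝ R :=
  LinearMap.ker ρ.flip

theorem append_update_left {V : Type*} {k l : ℕ} (X : Fin k → V) (Y : Fin l → V) (i : Fin k)
    (a : V) : Fin.append (Function.update X i a) Y =
      Function.update (Fin.append X Y) (Fin.castAdd l i) a := by
  ext j
  refine Fin.addCases (fun j => ?_) (fun j => ?_) j
  · by_cases h : j = i
    · subst h; simp
    · simp [h]
  · have : Fin.natAdd k j ≠ Fin.castAdd l i := fun h => by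
      have := congrArg Fin.val h
      simp at this
      omega
    simp [this]

theorem append_update_right {V : Type*} {k l : ℕ} (X : Fin k → V) (Y : Fin l → V) (i : Fin l)
    (a : V) : Fin.append X (Function.update Y i a) =
      Function.update (Fin.append X Y) (Fin.natAdd k i) a := by
  ext j
  refine Fin.addCases (fun j => ?_) (fun j => ?_) j
  · have : Fin.castAdd l j ≠ Fin.natAdd k i := fun h => by
      have := congrArg Fin.val h
      simp at this
      omega
    simp [this]
  · by_cases h : j = i
    · subst h; simp
    · simp [h]

/-- The alternating form `(Y₁, …, Yₗ) ↦ τ(X₁, …, Xₖ, Y₁, …, Yₗ)`. -/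
def contractVec {V : Type*} [AddCommGroup V] [Module ℝ V] [TopologicalSpace V]
    {k l N : ℕ} (h : k + l = N) (τ : V [⋀^Fin N]→L[ℝ] ℝ) (X : Fin k → V) :
    V [⋀^Fin l]→L[ℝ] ℝ where
  toFun Y := τ (Fin.append X Y ∘ Fin.cast h.symm)
  map_update_add' := by
    subst h
    intro inst Y i a b
    simp only [Fin.cast_refl, Function.comp_id]
    obtain rfl : inst = instDecidableEqFin l := Subsingleton.elim _ _
    simp only [append_update_right, ContinuousAlternatingMap.map_update_add]
  map_update_smul' := by
    subst h
    intro inst Y i c a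
    simp only [Fin.cast_refl, Function.comp_id]
    obtain rfl : inst = instDecidableEqFin l := Subsingleton.elim _ _
    simp only [append_update_right, ContinuousAlternatingMap.map_update_smul]
  map_eq_zero_of_eq' := by
    subst h
    intro Y i j hij hne
    simp only [Fin.cast_refl, Function.comp_id]
    exact τ.map_eq_zero_of_eq _ (i := Fin.natAdd k i) (j := Fin.natAdd k j) (by simpa using hij)
      (by simpa using hne)
  cont := by
    subst h
    refine τ.coe_continuous.comp (continuous_pi fun j => ?_)
    refine Fin.addCases (fun j => ?_) (fun j => ?_) j
    · simpa using continuous_const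
    · simpa using continuous_apply j

/-- The contraction `X ⌟ τ` of an alternating form `τ` of degree `N = k + l` with a `k`-vector `X`,
`((X₁ ∧ ⋯ ∧ Xₖ) ⌟ τ)(Y₁, …, Yₗ) = τ(X₁, …, Xₖ, Y₁, …, Yₗ)`, extended linearly in `X`. -/
def contract {V : Type*} [AddCommGroup V] [Module ℝ V] [TopologicalSpace V]
    {k l N : ℕ} (h : k + l = N) (τ : V [⋀^Fin N]→L[ℝ] ℝ) :
    ⋀[ℝ]^k V →ₗ[ℝ] V [⋀^Fin l]→L[ℝ] ℝ :=
  exteriorPower.alternatingMapLinearEquiv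
    { toFun := contractVec h τ
      map_update_add' := by
        subst h
        intro inst X i a b
        obtain rfl : inst = instDecidableEqFin k := Subsingleton.elim _ _
        ext Y
        change τ (Fin.append _ Y) = τ (Fin.append _ Y) + τ (Fin.append _ Y)
        simp only [append_update_left, ContinuousAlternatingMap.map_update_add]
      map_update_smul' := by
        subst h
        intro inst X i c a
        obtain rfl : inst = instDecidableEqFin k := Subsingleton.elim _ _
        ext Y
        change τ (Fin.append _ Y) = c • τ (Fin.append _ Y)
        simp only [append_update_left, ContinuousAlternatingMap.map_update_smul]
      map_eq_zero_of_eq' := by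
        subst h
        intro X i j hij hne
        ext Y
        exact τ.map_eq_zero_of_eq (Fin.append X Y) (i := Fin.castAdd l i) (j := Fin.castAdd l j)
          (by simpa using hij) (by simpa using hne) }

end Algebra
section Forms
variable {E : Type*} [NormedAddCommGroup E] [NormedSpace ℝ E]
  {M : Type*} [TopologicalSpace M] [ChartedSpace E M]

/-- The expression of a family of alternating forms on the tangent spaces in the chart at `x₀`:
its pullback under the inverse of the chart. -/
def chartRep {k : ℕ} (x₀ : M) (α : ∀ x : M, TangentSpace 𝓘(ℝ, E) x [⋀^Fin k]→L[ℝ] ℝ) (y : E) :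
    E [⋀^Fin k]→L[ℝ] ℝ :=
  (α ((extChartAt 𝓘(ℝ, E) x₀).symm y)).compContinuousLinearMap
    (mfderiv 𝓘(ℝ, E) 𝓘(ℝ, E) (extChartAt 𝓘(ℝ, E) x₀).symm y)

theorem chartRep_add {k : ℕ} (x₀ : M)
    (α β : ∀ x : M, TangentSpace 𝓘(ℝ, E) x [⋀^Fin k]→L[ℝ] ℝ) :
    chartRep x₀ (α + β) = chartRep x₀ α + chartRep x₀ β := rfl

theorem chartRep_smul {k : ℕ} (x₀ : M) (c : ℝ)
    (α : ∀ x : M, TangentSpace 𝓘(ℝ, E) x [⋀^Fin k]→L[ℝ] ℝ) :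
    chartRep x₀ (c • α) = c • chartRep x₀ α := rfl

variable (E M) in
/-- The space `Ω^k(M)` of smooth differential `k`-forms on `M`. -/
def DiffForm (k : ℕ) : Submodule ℝ (∀ x : M, TangentSpace 𝓘(ℝ, E) x [⋀^Fin k]→L[ℝ] ℝ) where
  carrier := {α | ∀ x₀ : M, ContDiffOn ℝ ∞ (chartRep x₀ α) (extChartAt 𝓘(ℝ, E) x₀).target}
  add_mem' ha hb x₀ := by
    rw [chartRep_add]
    exact (ha x₀).add (hb x₀)
  zero_mem' x₀ := contDiffOn_const (c := 0)
  smul_mem' c α ha x₀ := by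
    rw [chartRep_smul]
    exact contDiffOn_const.smul (ha x₀)

instance DiffForm.instAddCommGroup (k : ℕ) : AddCommGroup (DiffForm E M k) :=
  (DiffForm E M k).addCommGroup

/-- The exterior derivative at `x`, computed in the chart at `x`. -/
def extDerivAt {k : ℕ} (α : ∀ x : M, TangentSpace 𝓘(ℝ, E) x [⋀^Fin k]→L[ℝ] ℝ) (x : M) :
    TangentSpace 𝓘(ℝ, E) x [⋀^Fin (k + 1)]→L[ℝ] ℝ :=
  (extDeriv (chartRep x α) (extChartAt 𝓘(ℝ, E) x x)).compContinuousLinearMap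
    (mfderiv 𝓘(ℝ, E) 𝓘(ℝ, E) (extChartAt 𝓘(ℝ, E) x) x)

theorem target_mem_nhds (x₀ : M) {y : E} (hy : y ∈ (extChartAt 𝓘(ℝ, E) x₀).target) :
    (extChartAt 𝓘(ℝ, E) x₀).target ∈ nhds y :=
  (isOpen_extChartAt_target x₀).mem_nhds hy

theorem differentiableAt_chartRep {k : ℕ} (α : DiffForm E M k) (x₀ : M) {y : E}
    (hy : y ∈ (extChartAt 𝓘(ℝ, E) x₀).target) : DifferentiableAt ℝ (chartRep x₀ α.1) y :=
  ((α.2 x₀).contDiffAt (target_mem_nhds x₀ hy)).differentiableAt (by simp)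

variable [IsManifold 𝓘(ℝ, E) ∞ M]

theorem mdifferentiableAt_symm (x₀ : M) {y : E} (hy : y ∈ (extChartAt 𝓘(ℝ, E) x₀).target) :
    MDifferentiableAt 𝓘(ℝ, E) 𝓘(ℝ, E) (extChartAt 𝓘(ℝ, E) x₀).symm y := by
  have := mdifferentiableWithinAt_extChartAt_symm (I := 𝓘(ℝ, E)) hy
  rwa [ModelWithCorners.range_eq_univ, mdifferentiableWithinAt_univ] at this

/-- The transition map from the chart at `x₀` to the chart at `x`. -/
def transition (x₀ x : M) : E → E := extChartAt 𝓘(ℝ, E) x ∘ (extChartAt 𝓘(ℝ, E) x₀).symm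

theorem chartRep_eq_pullback {k : ℕ} (x₀ x : M)
    (α : ∀ x : M, TangentSpace 𝓘(ℝ, E) x [⋀^Fin k]→L[ℝ] ℝ) {y : E}
    (hy : y ∈ (extChartAt 𝓘(ℝ, E) x₀).target)
    (hx : (extChartAt 𝓘(ℝ, E) x₀).symm y ∈ (extChartAt 𝓘(ℝ, E) x).source) :
    chartRep x₀ α y =
      (chartRep x α (transition x₀ x y)).compContinuousLinearMap
        (fderiv ℝ (transition x₀ x) y) := by
  have hsrc : ∀ᶠ z in nhds y, (extChartAt 𝓘(ℝ, E) x₀).symm z ∈ (extChartAt 𝓘(ℝ, E) x).source :=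
    (mdifferentiableAt_symm x₀ hy).continuousAt.eventually
      ((isOpen_extChartAt_source x).mem_nhds hx)
  have hev : (extChartAt 𝓘(ℝ, E) x₀).symm =ᶠ[nhds y]
      (extChartAt 𝓘(ℝ, E) x).symm ∘ transition x₀ x := by
    filter_upwards [hsrc] with z hz
    exact ((extChartAt 𝓘(ℝ, E) x).left_inv hz).symm
  have hd1 : MDifferentiableAt 𝓘(ℝ, E) 𝓘(ℝ, E) (transition x₀ x) y :=
    (mdifferentiableAt_extChartAt (by simpa using hx)).comp y (mdifferentiableAt_symm x₀ hy)
  have hd2 : MDifferentiableAt 𝓘(ℝ, E) 𝓘(ℝ, E) (extChartAt 𝓘(ℝ, E) x).symm (transition x₀ x y) :=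
    mdifferentiableAt_symm x ((extChartAt 𝓘(ℝ, E) x).map_source hx)
  have hder : mfderiv 𝓘(ℝ, E) 𝓘(ℝ, E) (extChartAt 𝓘(ℝ, E) x₀).symm y =
      (mfderiv 𝓘(ℝ, E) 𝓘(ℝ, E) (extChartAt 𝓘(ℝ, E) x).symm (transition x₀ x y)) ∘L
        (mfderiv 𝓘(ℝ, E) 𝓘(ℝ, E) (transition x₀ x) y) := by
    rw [hev.mfderiv_eq]
    exact mfderiv_comp y hd2 hd1
  have hpt : (extChartAt 𝓘(ℝ, E) x).symm (transition x₀ x y) = (extChartAt 𝓘(ℝ, E) x₀).symm y :=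
    (extChartAt 𝓘(ℝ, E) x).left_inv hx
  have aux : ∀ (p q : M) (_ : p = q) (w : Fin k → E), α p w = α q w := by
    rintro p _ rfl w
    rfl
  ext v
  rw [← mfderiv_eq_fderiv]
  refine Eq.trans ?_ (aux _ _ hpt _).symm
  refine congrArg (α _) (funext fun i => ?_)
  exact DFunLike.congr_fun hder (v i)

theorem contDiffAt_transition (x₀ x : M) {y : E}
    (hy : y ∈ (extChartAt 𝓘(ℝ, E) x₀).target)
    (hx : (extChartAt 𝓘(ℝ, E) x₀).symm y ∈ (extChartAt 𝓘(ℝ, E) x).source) :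
    ContDiffAt ℝ ∞ (transition x₀ x) y := by
  rw [← contMDiffAt_iff_contDiffAt]
  have h1 : ContMDiffAt 𝓘(ℝ, E) 𝓘(ℝ, E) ∞ (extChartAt 𝓘(ℝ, E) x)
      ((extChartAt 𝓘(ℝ, E) x₀).symm y) :=
    contMDiffAt_extChartAt' (by rwa [extChartAt_source] at hx)
  have h2 : ContMDiffAt 𝓘(ℝ, E) 𝓘(ℝ, E) ∞ (extChartAt 𝓘(ℝ, E) x₀).symm y :=
    (contMDiffOn_extChartAt_symm x₀).contMDiffAt (target_mem_nhds x₀ hy)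
  exact h1.comp y h2

/-- The exterior derivative is computed by the usual formula in every chart. -/
theorem chartRep_extDerivAt {k : ℕ} (α : DiffForm E M k) (x₀ : M) {y : E}
    (hy : y ∈ (extChartAt 𝓘(ℝ, E) x₀).target) :
    chartRep x₀ (extDerivAt α.1) y = extDeriv (chartRep x₀ α.1) y := by
  set x := (extChartAt 𝓘(ℝ, E) x₀).symm y with hxdef
  have hx : x ∈ (extChartAt 𝓘(ℝ, E) x).source := mem_extChartAt_source x
  have hsrc : ∀ᶠ z in nhds y, (extChartAt 𝓘(ℝ, E) x₀).symm z ∈ (extChartAt 𝓘(ℝ, E) x).source :=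
    (mdifferentiableAt_symm x₀ hy).continuousAt.eventually
      ((isOpen_extChartAt_source x).mem_nhds hx)
  have hev : chartRep x₀ α.1 =ᶠ[nhds y] fun z =>
      (chartRep x α.1 (transition x₀ x z)).compContinuousLinearMap
        (fderiv ℝ (transition x₀ x) z) := by
    filter_upwards [hsrc, target_mem_nhds x₀ hy] with z hz hz'
    exact chartRep_eq_pullback x₀ x α.1 hz' hz
  have hT := contDiffAt_transition x₀ x hy hx
  have hα : DifferentiableAt ℝ (chartRep x α.1) (transition x₀ x y) := by
    have ht := (extChartAt 𝓘(ℝ, E) x).map_source hx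
    exact ((α.2 x).contDiffAt (target_mem_nhds x ht)).differentiableAt (by simp)
  rw [hev.extDeriv_eq, extDeriv_pullback hα hT
    (minSmoothness_of_isRCLikeNormedField.trans_le ENat.LEInfty.out)]
  have hd1 : fderiv ℝ (transition x₀ x) y = (mfderiv 𝓘(ℝ, E) 𝓘(ℝ, E) (extChartAt 𝓘(ℝ, E) x) x) ∘L
      (mfderiv 𝓘(ℝ, E) 𝓘(ℝ, E) (extChartAt 𝓘(ℝ, E) x₀).symm y) := by
    rw [← mfderiv_eq_fderiv]
    exact mfderiv_comp y (mdifferentiableAt_extChartAt (by rwa [extChartAt_source] at hx))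
      (mdifferentiableAt_symm x₀ hy)
  rw [hd1]
  rfl

theorem chartRep_extDerivAt_eqOn {k : ℕ} (α : DiffForm E M k) (x₀ : M) :
    Set.EqOn (chartRep x₀ (extDerivAt α.1)) (extDeriv (chartRep x₀ α.1))
      (extChartAt 𝓘(ℝ, E) x₀).target :=
  fun _ hy => chartRep_extDerivAt α x₀ hy

/-- The exterior derivative `d : Ω^k(M) → Ω^{k+1}(M)`. -/
def extDer (k : ℕ) : DiffForm E M k →ₗ[ℝ] DiffForm E M (k + 1) where
  toFun α := ⟨extDerivAt α.1, fun x₀ => by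
    refine ContDiffOn.congr ?_ (chartRep_extDerivAt_eqOn α x₀)
    exact (ContinuousAlternatingMap.alternatizeUncurryFinCLM ℝ E ℝ).contDiff.comp_contDiffOn
      ((α.2 x₀).fderiv_of_isOpen (isOpen_extChartAt_target x₀) (m := ∞) (by simp))⟩
  map_add' α β := by
    refine Subtype.ext (funext fun x => ?_)
    have hx := mem_extChartAt_target (I := 𝓘(ℝ, E)) x
    change extDerivAt (α.1 + β.1) x = extDerivAt α.1 x + extDerivAt β.1 x
    unfold extDerivAt
    rw [chartRep_add, extDeriv_add (differentiableAt_chartRep α x hx)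
      (differentiableAt_chartRep β x hx)]
    rfl
  map_smul' c α := by
    refine Subtype.ext (funext fun x => ?_)
    change extDerivAt (c • α.1) x = c • extDerivAt α.1 x
    unfold extDerivAt
    rw [chartRep_smul, extDeriv_smul]
    rfl

theorem extDer_extDer {k : ℕ} (α : DiffForm E M k) : extDer (k + 1) (extDer k α) = 0 := by
  refine Subtype.ext (funext fun x => ?_)
  change extDerivAt (extDerivAt α.1) x = 0
  have hx := mem_extChartAt_target (I := 𝓘(ℝ, E)) x
  have hev : chartRep x (extDerivAt α.1) =ᶠ[nhds (extChartAt 𝓘(ℝ, E) x x)]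
      extDeriv (chartRep x α.1) :=
    (chartRep_extDerivAt_eqOn α x).eventuallyEq_of_mem (target_mem_nhds x hx)
  change (extDeriv (chartRep x (extDerivAt α.1)) _).compContinuousLinearMap _ = 0
  rw [hev.extDeriv_eq, extDeriv_extDeriv_apply ((α.2 x).contDiffAt (target_mem_nhds x hx))
    (minSmoothness_of_isRCLikeNormedField.trans_le ENat.LEInfty.out)]
  rfl

variable (E M) in
/-- The space `Ω^k_cl(M)` of closed `k`-forms. -/
def ClosedForm (k : ℕ) : Submodule ℝ (DiffForm E M k) := LinearMap.ker (extDer k)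

instance ClosedForm.instAddCommGroup (k : ℕ) : AddCommGroup (ClosedForm E M k) :=
  (ClosedForm E M k).addCommGroup

variable (E M) in
/-- The space `Γ(TM)` of smooth vector fields. -/
abbrev VField := Cₛ^∞⟮𝓘(ℝ, E); E, (TangentSpace 𝓘(ℝ, E) : M → Type _)⟯

/-- The contraction of a form with a vector field at `x`. -/
def interiorAt {k : ℕ} (X : ∀ x : M, TangentSpace 𝓘(ℝ, E) x)
    (α : ∀ x : M, TangentSpace 𝓘(ℝ, E) x [⋀^Fin (k + 1)]→L[ℝ] ℝ) (x : M) :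
    TangentSpace 𝓘(ℝ, E) x [⋀^Fin k]→L[ℝ] ℝ :=
  ContinuousAlternatingMap.curryLeft (E := E) (α x) (X x)

theorem contDiffOn_vectorField (X : VField E M) (x₀ : M) :
    ContDiffOn ℝ ∞ (fun y => (mfderiv 𝓘(ℝ, E) 𝓘(ℝ, E) (extChartAt 𝓘(ℝ, E) x₀)
      ((extChartAt 𝓘(ℝ, E) x₀).symm y) (X ((extChartAt 𝓘(ℝ, E) x₀).symm y)) : E))
      (extChartAt 𝓘(ℝ, E) x₀).target := by
  have h := ((trivializationAt E (TangentSpace 𝓘(ℝ, E) : M → Type _)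
    x₀).contMDiffOn_section_baseSet_iff (IB := 𝓘(ℝ, E)) (n := ∞)).1 X.contMDiff.contMDiffOn
  have h2 := h.comp (contMDiffOn_extChartAt_symm (I := 𝓘(ℝ, E)) (n := ∞) x₀) (fun y hy => by
    simpa using (extChartAt 𝓘(ℝ, E) x₀).map_target hy)
  rw [contMDiffOn_iff_contDiffOn] at h2
  refine h2.congr fun y hy => ?_
  have hs : (extChartAt 𝓘(ℝ, E) x₀).symm y ∈ (chartAt E x₀).source := by
    simpa using (extChartAt 𝓘(ℝ, E) x₀).map_target hy
  refine (DFunLike.congr_fun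
    (TangentBundle.continuousLinearMapAt_trivializationAt (I := 𝓘(ℝ, E)) hs).symm _).trans ?_
  exact congrFun (Bundle.Trivialization.coe_linearMapAt_of_mem _ hs) _

theorem chartRep_interiorAt {k : ℕ} (X : ∀ x : M, TangentSpace 𝓘(ℝ, E) x)
    (α : ∀ x : M, TangentSpace 𝓘(ℝ, E) x [⋀^Fin (k + 1)]→L[ℝ] ℝ) (x₀ : M) {y : E}
    (hy : y ∈ (extChartAt 𝓘(ℝ, E) x₀).target) :
    chartRep x₀ (interiorAt X α) y = (chartRep x₀ α y).curryLeft
      (mfderiv 𝓘(ℝ, E) 𝓘(ℝ, E) (extChartAt 𝓘(ℝ, E) x₀)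
        ((extChartAt 𝓘(ℝ, E) x₀).symm y) (X ((extChartAt 𝓘(ℝ, E) x₀).symm y)) : E) := by
  have h := mfderivWithin_extChartAt_symm_comp_mfderiv_extChartAt (I := 𝓘(ℝ, E)) hy
  rw [ModelWithCorners.range_eq_univ, mfderivWithin_univ] at h
  have h2 := DFunLike.congr_fun h (X ((extChartAt 𝓘(ℝ, E) x₀).symm y))
  ext v
  change α _ (Matrix.vecCons _ _) = α _ _
  congr 1
  ext i
  refine Fin.cases ?_ (fun j => ?_) i
  · exact h2.symm
  · rfl

/-- The interior product `X ⌟ α`, bilinear in the vector field and the form. -/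
def interior (k : ℕ) : VField E M →ₗ[ℝ] DiffForm E M (k + 1) →ₗ[ℝ] DiffForm E M k :=
  LinearMap.mk₂ ℝ
    (fun X α => ⟨interiorAt X α.1, fun x₀ => by
      refine ContDiffOn.congr ?_ (fun y hy => chartRep_interiorAt X α.1 x₀ hy)
      exact ((ContinuousAlternatingMap.curryLeftLI
        (𝕜 := ℝ) (E := E) (F := ℝ) (n := k)).toContinuousLinearMap.contDiff.comp_contDiffOn
          (α.2 x₀)).clm_apply (contDiffOn_vectorField X x₀)⟩)
    (fun X Y α => Subtype.ext (funext fun x =>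
      map_add (ContinuousAlternatingMap.curryLeft (E := E) (α.1 x)) (X x) (Y x)))
    (fun c X α => Subtype.ext (funext fun x =>
      map_smul (ContinuousAlternatingMap.curryLeft (E := E) (α.1 x)) c (X x)))
    (fun _ _ _ => rfl)
    (fun _ _ _ => rfl)

/-- The Lie derivative `L_X α = d(X ⌟ α) + X ⌟ dα`, where `X ⌟ α = 0` if `α` has degree `0`. -/
def lieDer : (k : ℕ) → VField E M →ₗ[ℝ] DiffForm E M k →ₗ[ℝ] DiffForm E M k
  | 0 => (interior 0).compl₂ (extDer 0)
  | k + 1 => (interior k).compr₂ (extDer k) + (interior (k + 1)).compl₂ (extDer (k + 1))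

theorem lieDer_mem_closedForm (k : ℕ) (X : VField E M) (α : DiffForm E M k)
    (hα : α ∈ ClosedForm E M k) : lieDer k X α ∈ ClosedForm E M k := by
  have h : extDer k α = 0 := hα
  change extDer k (lieDer k X α) = 0
  cases k with
  | zero =>
    have : lieDer 0 X α = interior 0 X (extDer 0 α) := rfl
    rw [this, h, map_zero, map_zero]
  | succ k =>
    have : lieDer (k + 1) X α =
      extDer k (interior k X α) + interior (k + 1) X (extDer (k + 1) α) := rfl
    rw [this, h, map_zero, add_zero, extDer_extDer]

end Forms

section Action
variable {E : Type*} [NormedAddCommGroup E] [NormedSpace ℝ E]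
  {M : Type*} [TopologicalSpace M] [ChartedSpace E M] [IsManifold 𝓘(ℝ, E) ∞ M]
  {F : Type*} [NormedAddCommGroup F] [NormedSpace ℝ F]
  {G : Type*} [TopologicalSpace G] [ChartedSpace F G] [Group G] [LieGroup 𝓘(ℝ, F) ∞ G]
  [MulAction G M] [ContMDiffSMul 𝓘(ℝ, F) 𝓘(ℝ, E) ∞ G M]

instance instLieGroupMinSmoothness : LieGroup 𝓘(ℝ, F) (minSmoothness ℝ 3) G :=
  LieGroup.of_le (n := ∞) (minSmoothness_of_isRCLikeNormedField.trans_le ENat.LEInfty.out)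

variable (E F G) in
/-- The infinitesimal generator `V_ξ(x)` of the action at `x`, as a linear function of `ξ`: the
derivative at `1` of the orbit map `g ↦ g • x`. -/
def infGenAt (x : M) : GroupLieAlgebra 𝓘(ℝ, F) G →ₗ[ℝ] TangentSpace 𝓘(ℝ, E) x :=
  (mfderiv 𝓘(ℝ, F) 𝓘(ℝ, E) (fun g : G => g • x) 1 :
    GroupLieAlgebra 𝓘(ℝ, F) G →ₗ[ℝ] TangentSpace 𝓘(ℝ, E) ((1 : G) • x))

theorem contMDiff_infGenAt (ξ : GroupLieAlgebra 𝓘(ℝ, F) G) :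
    ContMDiff 𝓘(ℝ, E) 𝓘(ℝ, E).tangent ∞
      (fun x : M => (⟨x, infGenAt E F G x ξ⟩ : TangentBundle 𝓘(ℝ, E) M)) := by
  let f₁ : M → TangentBundle 𝓘(ℝ, F) G × TangentBundle 𝓘(ℝ, E) M :=
    fun x => (⟨1, ξ⟩, ⟨x, 0⟩)
  have s₁ : ContMDiff 𝓘(ℝ, E) (𝓘(ℝ, F).tangent.prod 𝓘(ℝ, E).tangent) ∞ f₁ :=
    contMDiff_const.prodMk (Bundle.contMDiff_zeroSection ℝ (TangentSpace 𝓘(ℝ, E) : M → Type _))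
  let f₂ := (equivTangentBundleProd 𝓘(ℝ, F) G 𝓘(ℝ, E) M).symm
  have s₂ : ContMDiff (𝓘(ℝ, F).tangent.prod 𝓘(ℝ, E).tangent) (𝓘(ℝ, F).prod 𝓘(ℝ, E)).tangent ∞ f₂ :=
    contMDiff_equivTangentBundleProd_symm
  have sm : ContMDiff (𝓘(ℝ, F).prod 𝓘(ℝ, E)) 𝓘(ℝ, E) ∞ (fun p : G × M => p.1 • p.2) :=
    ContMDiffSMul.contMDiff_smul
  let f₃ := tangentMap (𝓘(ℝ, F).prod 𝓘(ℝ, E)) 𝓘(ℝ, E) (fun p : G × M => p.1 • p.2)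
  have s₃ : ContMDiff (𝓘(ℝ, F).prod 𝓘(ℝ, E)).tangent 𝓘(ℝ, E).tangent ∞ f₃ :=
    sm.contMDiff_tangentMap (m := ∞) (by simp)
  refine ((s₃.comp s₂).comp s₁).congr fun x => ?_
  have hd := mfderiv_prod_eq_add_apply (I := 𝓘(ℝ, F)) (I' := 𝓘(ℝ, E)) (I'' := 𝓘(ℝ, E))
    (p := ((1 : G), x)) (v := ((ξ : TangentSpace 𝓘(ℝ, F) (1 : G)), (0 : TangentSpace 𝓘(ℝ, E) x)))
    (sm.mdifferentiableAt (by simp))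
  have aux : ∀ (a b : M) (_ : a = b) (u : E),
      (⟨a, u⟩ : TangentBundle 𝓘(ℝ, E) M) = ⟨b, u⟩ := by
    rintro a _ rfl u
    rfl
  refine (aux _ _ (one_smul G x).symm _).trans ?_
  refine congrArg (Bundle.TotalSpace.mk ((1 : G) • x)) ?_
  refine Eq.trans ?_ hd.symm
  exact (add_zero _).symm.trans (congrArg _ (map_zero _).symm)

variable (E M F G) in
/-- The vector field `V_ξ` of the action. -/
def infGen : GroupLieAlgebra 𝓘(ℝ, F) G →ₗ[ℝ] VField E M where
  toFun ξ := ⟨fun x => infGenAt E F G x ξ, contMDiff_infGenAt ξ⟩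
  map_add' ξ η := ContMDiffSection.ext fun x => map_add (infGenAt E F G x) ξ η
  map_smul' c ξ := ContMDiffSection.ext fun x => map_smul (infGenAt E F G x) c ξ

variable (E M F G) in
/-- The action of the Lie algebra on closed `k`-forms, `ξ · α = -L_{V_ξ} α`. It is the derivative
of the action `g · α = Φ_{g⁻¹}^* α` of the group. -/
def closedFormAction (k : ℕ) :
    GroupLieAlgebra 𝓘(ℝ, F) G →ₗ[ℝ] Module.End ℝ (ClosedForm E M k) where
  toFun ξ :=
    { toFun := fun α => ⟨-lieDer k (infGen E M F G ξ) α.1,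
        neg_mem (lieDer_mem_closedForm k (infGen E M F G ξ) α.1 α.2)⟩
      map_add' := fun α β => Subtype.ext (by
        change -lieDer k (infGen E M F G ξ) (α.1 + β.1) =
          -lieDer k (infGen E M F G ξ) α.1 + -lieDer k (infGen E M F G ξ) β.1
        rw [map_add, neg_add])
      map_smul' := fun c α => Subtype.ext (by
        change -lieDer k (infGen E M F G ξ) (c • α.1) = c • -lieDer k (infGen E M F G ξ) α.1
        rw [map_smul, smul_neg]) }
  map_add' ξ η := by
    refine LinearMap.ext fun α => Subtype.ext ?_
    change -lieDer k (infGen E M F G (ξ + η)) α.1 =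
      -lieDer k (infGen E M F G ξ) α.1 + -lieDer k (infGen E M F G η) α.1
    rw [map_add, map_add, LinearMap.add_apply, neg_add]
  map_smul' c ξ := by
    refine LinearMap.ext fun α => Subtype.ext ?_
    change -lieDer k (infGen E M F G (c • ξ)) α.1 = c • -lieDer k (infGen E M F G ξ) α.1
    rw [map_smul, map_smul, LinearMap.smul_apply, smul_neg]

/-- The multivector `V_p(x) = V_{ξ₁}(x) ∧ ⋯ ∧ V_{ξₖ}(x)` for `p = ξ₁ ∧ ⋯ ∧ ξₖ`, extended linearly
to all `p ∈ Λ^k 𝔤`. -/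
def genMultivector {k : ℕ} (p : ⋀[ℝ]^k (GroupLieAlgebra 𝓘(ℝ, F) G)) (x : M) :
    ⋀[ℝ]^k (TangentSpace 𝓘(ℝ, E) x) :=
  exteriorPower.map k (infGenAt E F G x) p

/-- The derivative at `x` of the chart at `x₀`. -/
def chartDeriv (x₀ x : M) : TangentSpace 𝓘(ℝ, E) x →ₗ[ℝ] E :=
  (mfderiv 𝓘(ℝ, E) 𝓘(ℝ, E) (extChartAt 𝓘(ℝ, E) x₀) x).toLinearMap

/-- Smoothness of a family of `k`-vectors on the tangent spaces: in every chart, its components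
are smooth functions. -/
def IsSmoothMultivectorField {k : ℕ} (X : ∀ x : M, ⋀[ℝ]^k (TangentSpace 𝓘(ℝ, E) x)) : Prop :=
  ∀ (x₀ : M) (ℓ : ⋀[ℝ]^k E →ₗ[ℝ] ℝ), ContDiffOn ℝ ∞
    (fun y => ℓ (exteriorPower.map k
      (chartDeriv x₀ ((extChartAt 𝓘(ℝ, E) x₀).symm y))
      (X ((extChartAt 𝓘(ℝ, E) x₀).symm y))))
    (extChartAt 𝓘(ℝ, E) x₀).target

/-- An `n`-plectic form: a closed `(n+1)`-form `Ω` such that `v ↦ v ⌟ Ω` is injective on every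
tangent space. -/
structure IsPlectic {n : ℕ} (Ω : DiffForm E M (n + 1)) : Prop where
  closed : extDer (n + 1) Ω = 0
  nondegenerate : ∀ x : M, Function.Injective (fun v : TangentSpace 𝓘(ℝ, E) x =>
    ContinuousAlternatingMap.curryLeft (E := E) (Ω.1 x) v)

variable (G) in
/-- The action of `G` preserves the form `Ω`: `Φ_g^* Ω = Ω` for every `g`. -/
def PreservesForm {k : ℕ} (Ω : DiffForm E M k) : Prop :=
  ∀ (g : G) (x : M), (Ω.1 (g • x)).compContinuousLinearMap
    (mfderiv 𝓘(ℝ, E) 𝓘(ℝ, E) (fun y : M => g • y) x) = Ω.1 x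

/-- Hamiltonian `(n-k)`-forms: there is a smooth `k`-vector field `X` with `dα = -X ⌟ Ω`. -/
def IsHamiltonianForm {n : ℕ} (Ω : DiffForm E M (n + 1)) (k : ℕ) (hk : k ≤ n)
    (α : DiffForm E M (n - k)) : Prop :=
  ∃ X : ∀ x : M, ⋀[ℝ]^k (TangentSpace 𝓘(ℝ, E) x), IsSmoothMultivectorField X ∧
    ∀ x : M, (extDer (n - k) α).1 x =
      -contract (show k + (n - k + 1) = n + 1 by omega) (Ω.1 x) (X x)

/-- The sign `ζ(k) = -(-1)^{k(k+1)/2}`. -/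
def zetaSign (k : ℕ) : ℝ := -(-1) ^ (k * (k + 1) / 2)

variable [FiniteDimensional ℝ F]

/-- A weak `k`-moment map: a linear map `f : P_{𝔤,k} → Ω^{n-k}_Ham(M)` with
`d f(p) = -ζ(k) V_p ⌟ Ω`. -/
structure IsWeakMomentComponent {n : ℕ} (Ω : DiffForm E M (n + 1)) (k : ℕ) (hk : k ≤ n)
    (f : lieKernel (GroupLieAlgebra 𝓘(ℝ, F) G) k →ₗ[ℝ] DiffForm E M (n - k)) : Prop where
  hamiltonian : ∀ p, IsHamiltonianForm Ω k hk (f p)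
  extDer_eq : ∀ (p : lieKernel (GroupLieAlgebra 𝓘(ℝ, F) G) k) (x : M),
    (extDer (n - k) (f p)).1 x =
      -(zetaSign k • contract (show k + (n - k + 1) = n + 1 by omega) (Ω.1 x)
        (genMultivector p.1 x))

/-- A (full) weak moment map: a family of weak `k`-moment maps for `1 ≤ k ≤ n`. -/
def IsWeakMomentMap {n : ℕ} (Ω : DiffForm E M (n + 1))
    (f : ∀ k : ℕ, 1 ≤ k → k ≤ n →
      (lieKernel (GroupLieAlgebra 𝓘(ℝ, F) G) k →ₗ[ℝ] DiffForm E M (n - k))) : Prop :=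
  ∀ (k : ℕ) (hk₁ : 1 ≤ k) (hk : k ≤ n), IsWeakMomentComponent Ω k hk (f k hk₁ hk)

end Action

end Multisymplectic

end

open Multisymplectic
open scoped Manifold ContDiff

/-! The obstruction to a weak `k`-moment map is whether the forms `V_p ⌟ Ω`, for `p` in the Lie
kernel, are exact.

Since `Ω` is closed and invariant, and `[V_ξ, V_η] = -V_[ξ,η]`, Cartan's formula shows that `d` of
the contraction of `Ω` with `x` is the contraction with `∂x` (`totalExtDer_genContraction`). So for
`∂p = 0` the contraction with `p` is closed. Cartan's formula once more, now for `L_{V_ξ}` of this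
closed form, gives `V_{ad_ξ p} ⌟ Ω` up to sign on one side and an exact form on the other
(`genContraction_adExt`).

The vanishing of `H⁰` of the dual of the Lie kernel says that no nonzero functional annihilates all
`ad_ξ p`, so these elements span the Lie kernel (`eq_top_of_lieH0_coadKernel_eq_bot`). Hence every
`V_p ⌟ Ω` is exact, and composing with a linear section of `d` over its range gives the moment map
(`exists_weakMomentComponent`). The section is arbitrary, so nothing equivariant is obtained.

The second criterion reduces to the first: a nonzero invariant functional `c` and a nonzero
invariant closed form `s` would give the nonzero invariant `c ⊗ s` (`lieH0_eq_bot_of_tensor`).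

The analytic input is Cartan calculus in charts: `L_X` as a coordinate expression
(`chartRep_lieDer`), its commutator with interior products (`lieDer_interior`), the bracket of
generators (`lieBracket_chartField_infGen`), and `L_{V_ξ} Ω = 0` (`lieDer_infGen_eq_zero`). -/

open scoped Manifold ContDiff
noncomputable section
namespace Multisymplectic

/-! ### Cartan calculus on a normed space -/

section LocalCalculus
variable {E : Type*} [NormedAddCommGroup E] [NormedSpace ℝ E]

theorem hasFDerivAt_curryLeft {k : ℕ} {τ : E → E [⋀^Fin (k + 1)]→L[ℝ] ℝ} {X : E → E} {y : E}
    (hτ : DifferentiableAt ℝ τ y) (hX : DifferentiableAt ℝ X y) :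
    HasFDerivAt (fun z => (τ z).curryLeft (X z))
      ((τ y).curryLeft ∘L fderiv ℝ X y +
        ((ContinuousAlternatingMap.curryLeftLI (𝕜 := ℝ) (E := E) (F := ℝ)
          (n := k)).toContinuousLinearMap ∘L fderiv ℝ τ y).flip (X y)) y := by
  have h : HasFDerivAt (fun z => (τ z).curryLeft)
      ((ContinuousAlternatingMap.curryLeftLI (𝕜 := ℝ) (E := E) (F := ℝ)
        (n := k)).toContinuousLinearMap ∘L fderiv ℝ τ y) y := by
    have h1 := ContinuousLinearMap.hasFDerivAt (x := τ y) (ContinuousAlternatingMap.curryLeftLI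
      (𝕜 := ℝ) (E := E) (F := ℝ) (n := k)).toContinuousLinearMap
    have h2 := HasFDerivAt.comp (F := E [⋀^Fin (k + 1)]→L[ℝ] ℝ)
      (G := E →L[ℝ] E [⋀^Fin k]→L[ℝ] ℝ) y h1 hτ.hasFDerivAt
    exact h2
  exact h.clm_apply hX.hasFDerivAt

theorem fderiv_curryLeft_apply {k : ℕ} {τ : E → E [⋀^Fin (k + 1)]→L[ℝ] ℝ} {X : E → E} {y : E}
    (hτ : DifferentiableAt ℝ τ y) (hX : DifferentiableAt ℝ X y) (u : E) (v : Fin k → E) :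
    fderiv ℝ (fun z => (τ z).curryLeft (X z)) y u v =
      τ y (Matrix.vecCons (fderiv ℝ X y u) v) + fderiv ℝ τ y u (Matrix.vecCons (X y) v) := by
  rw [(hasFDerivAt_curryLeft hτ hX).fderiv]
  rfl

/-- The coordinate expression `D_X τ (v₁, …, vₖ) + ∑ᵢ τ (v₁, …, DX vᵢ, …, vₖ)` of the Lie
derivative of a form on a vector space. -/
def coordLieDeriv {k : ℕ} (X : E → E) (τ : E → E [⋀^Fin k]→L[ℝ] ℝ) (y : E) (v : Fin k → E) : ℝ :=
  fderiv ℝ τ y (X y) v + ∑ i, τ y (Function.update v i (fderiv ℝ X y (v i)))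

/-- With `a = X y`, the subtracted sum is exactly what cancels the derivatives of `τ` in `d(X ⌟ τ)`
in Cartan's formula. -/
theorem extDeriv_vecCons {k : ℕ} (τ : E → E [⋀^Fin (k + 1)]→L[ℝ] ℝ) (y a : E)
    (v : Fin (k + 1) → E) :
    extDeriv τ y (Matrix.vecCons a v) = fderiv ℝ τ y a v -
      ∑ i : Fin (k + 1), (-1 : ℤ) ^ (i : ℕ) •
        fderiv ℝ τ y (v i) (Matrix.vecCons a (i.removeNth v)) := by
  rw [extDeriv, ContinuousAlternatingMap.alternatizeUncurryFin_apply, Fin.sum_univ_succ,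
    sub_eq_add_neg, ← Finset.sum_neg_distrib]
  congr 1
  · simp [Fin.removeNth_zero]
  · refine Finset.sum_congr rfl fun i _ => ?_
    have h : i.succ.removeNth (Matrix.vecCons a v) = Matrix.vecCons a (i.removeNth v) := by
      ext j
      refine Fin.cases ?_ (fun j => ?_) j
      · simp [Fin.removeNth]
      · simp [Fin.removeNth]
    rw [h, Fin.val_succ, pow_succ, mul_neg_one, neg_smul]
    simp

/-- Cartan's formula for a function. -/
theorem extDeriv_vecCons_zero (X : E → E) (τ : E → E [⋀^Fin 0]→L[ℝ] ℝ) (y : E) (v : Fin 0 → E) :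
    extDeriv τ y (Matrix.vecCons (X y) v) = coordLieDeriv X τ y v := by
  rw [extDeriv, ContinuousAlternatingMap.alternatizeUncurryFin_apply, coordLieDeriv]
  simp [Fin.removeNth_zero]

/-- Cartan's formula for a form of positive degree. -/
theorem extDeriv_curryLeft_add {k : ℕ} {τ : E → E [⋀^Fin (k + 1)]→L[ℝ] ℝ} {X : E → E} {y : E}
    (hτ : DifferentiableAt ℝ τ y) (hX : DifferentiableAt ℝ X y) (v : Fin (k + 1) → E) :
    extDeriv (fun z => (τ z).curryLeft (X z)) y v + extDeriv τ y (Matrix.vecCons (X y) v) =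
      coordLieDeriv X τ y v := by
  -- Moving slot `i` to the front costs `(-1)^i`; this matches the terms of `coordLieDeriv`
  -- containing `DX` with those of `d(X ⌟ τ)`.
  have h (i : Fin (k + 1)) (a : E) : τ y (Function.update v i a) =
      (-1 : ℤ) ^ (i : ℕ) • τ y (Matrix.vecCons a (i.removeNth v)) := by
    rw [← Fin.insertNth_removeNth]
    simpa using (τ y).toAlternatingMap.map_insertNth i a (i.removeNth v)
  rw [extDeriv_vecCons, extDeriv, ContinuousAlternatingMap.alternatizeUncurryFin_apply,
    coordLieDeriv]
  simp only [fderiv_curryLeft_apply hτ hX, h, smul_add, Finset.sum_add_distrib]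
  ring

/-- The commutator of the Lie derivative with the interior product. -/
theorem coordLieDeriv_curryLeft {k : ℕ} {τ : E → E [⋀^Fin (k + 1)]→L[ℝ] ℝ} {X Y : E → E} {y : E}
    (hτ : DifferentiableAt ℝ τ y) (hY : DifferentiableAt ℝ Y y) (v : Fin k → E) :
    coordLieDeriv X (fun z => (τ z).curryLeft (Y z)) y v =
      coordLieDeriv X τ y (Matrix.vecCons (Y y) v) +
        τ y (Matrix.vecCons (VectorField.lieBracket ℝ X Y y) v) := by
  have h (i : Fin k) (a : E) : Function.update (Matrix.vecCons (Y y) v) i.succ a =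
      Matrix.vecCons (Y y) (Function.update v i a) := by
    ext j
    refine Fin.cases ?_ (fun j => ?_) j
    · simp [Function.update_of_ne (Fin.succ_ne_zero i).symm]
    · by_cases h : j = i
      · subst h; simp
      · simp [h]
  have h0 (a : E) : Function.update (Matrix.vecCons (Y y) v) 0 a = Matrix.vecCons a v := by
    ext j
    refine Fin.cases ?_ (fun j => ?_) j <;> simp
  -- The two halves of the bracket: `DY X` comes from the product rule for `Y ⌟ τ`, and `DX Y` is
  -- the slot `0` term of the Lie derivative evaluated on `(Y, v)`.
  have hsub : τ y (Matrix.vecCons (VectorField.lieBracket ℝ X Y y) v) =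
      τ y (Matrix.vecCons (fderiv ℝ Y y (X y)) v) - τ y (Matrix.vecCons (fderiv ℝ X y (Y y)) v) :=
    congrArg (fun f => f v) (map_sub (τ y).curryLeft (fderiv ℝ Y y (X y)) (fderiv ℝ X y (Y y)))
  rw [coordLieDeriv, coordLieDeriv, fderiv_curryLeft_apply hτ hY, Fin.sum_univ_succ, hsub]
  simp only [ContinuousAlternatingMap.curryLeft_apply_apply, h, h0, Matrix.cons_val_succ,
    Matrix.cons_val_zero]
  ring

/-- Lie brackets of related vector fields are related. -/
theorem fderiv_lieBracket_of_related {F : Type*} [NormedAddCommGroup F] [NormedSpace ℝ F]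
    {f : F → E} {V W : F → F} {X Y : E → E} {a : F} (hf : ContDiffAt ℝ 2 f a)
    (hV : DifferentiableAt ℝ V a) (hW : DifferentiableAt ℝ W a)
    (hX : DifferentiableAt ℝ X (f a)) (hY : DifferentiableAt ℝ Y (f a))
    (hVX : ∀ᶠ z in nhds a, fderiv ℝ f z (V z) = X (f z))
    (hWY : ∀ᶠ z in nhds a, fderiv ℝ f z (W z) = Y (f z)) :
    fderiv ℝ f a (VectorField.lieBracket ℝ V W a) = VectorField.lieBracket ℝ X Y (f a) := by
  have hfa : DifferentiableAt ℝ f a := hf.differentiableAt (by simp)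
  -- By symmetry of the second derivative of `f`, the left side is `D(Df W) V - D(Df V) W`; near `a`
  -- the inner functions are `Y ∘ f` and `X ∘ f`, and the chain rule finishes.
  rw [VectorField.fderiv_apply_lieBracket hf (by simp) hW hV,
    Filter.EventuallyEq.fderiv_eq (f := fun z => Y (f z)) hWY,
    Filter.EventuallyEq.fderiv_eq (f := fun z => X (f z)) hVX,
    fderiv_fun_comp a hY hfa, fderiv_fun_comp a hX hfa]
  simp only [ContinuousLinearMap.comp_apply, hVX.self_of_nhds, hWY.self_of_nhds]
  rfl

/-- If the pullback of `τ` along a family of maps `φ_t` with `φ_0 = id` is constant, then the Lie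
derivative of `τ` along the velocity field of the family vanishes. -/
theorem coordLieDeriv_eq_zero_of_pullback {k : ℕ} {τ : E → E [⋀^Fin k]→L[ℝ] ℝ}
    {φ : ℝ × E → E} {y : E} (hτ : DifferentiableAt ℝ τ y) (hφ : ContDiffAt ℝ 2 φ (0, y))
    (h0 : ∀ᶠ z in nhds y, φ (0, z) = z)
    (hinv : ∀ᶠ t in nhds (0 : ℝ), (τ (φ (t, y))).compContinuousLinearMap
      (fderiv ℝ (fun z => φ (t, z)) y) = τ y) (v : Fin k → E) :
    coordLieDeriv (fun z => fderiv ℝ φ (0, z) (1, 0)) τ y v = 0 := by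
  have hd : ∀ᶠ p in nhds ((0 : ℝ), y), DifferentiableAt ℝ φ p :=
    (hφ.eventually (by simp)).mono fun p hp => hp.differentiableAt (by simp)
  have hφ' : DifferentiableAt ℝ (fderiv ℝ φ) (0, y) :=
    (hφ.fderiv_right (m := 1) (by norm_num)).differentiableAt (by simp)
  have hl (t : ℝ) (z : E) : HasFDerivAt (fun z : E => (t, z)) (ContinuousLinearMap.inr ℝ ℝ E) z :=
    hasFDerivAt_prodMk_right t z
  have hr (t : ℝ) (z : E) : HasFDerivAt (fun t : ℝ => (t, z)) (ContinuousLinearMap.inl ℝ ℝ E) t :=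
    hasFDerivAt_prodMk_left t z
  have hslice (t : ℝ) (ht : DifferentiableAt ℝ φ (t, y)) :
      fderiv ℝ (fun z => φ (t, z)) y = fderiv ℝ φ (t, y) ∘L ContinuousLinearMap.inr ℝ ℝ E :=
    (ht.hasFDerivAt.comp y (hl t y)).fderiv
  have hy : φ (0, y) = y := h0.self_of_nhds
  have hid : fderiv ℝ φ (0, y) ∘L ContinuousLinearMap.inr ℝ ℝ E = ContinuousLinearMap.id ℝ E := by
    rw [← hslice 0 hd.self_of_nhds,
      Filter.EventuallyEq.fderiv_eq (f := fun z => z) h0, fderiv_fun_id]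
  -- The derivative of the velocity field is a mixed second derivative of `φ`, differentiated first
  -- in `t` and then in `z`.
  have hX : fderiv ℝ (fun z => fderiv ℝ φ (0, z) (1, 0)) y =
      ((fderiv ℝ (fderiv ℝ φ) (0, y)) ∘L ContinuousLinearMap.inr ℝ ℝ E).flip (1, 0) := by
    have h1 : HasFDerivAt (fun z => fderiv ℝ φ (0, z))
      ((fderiv ℝ (fderiv ℝ φ) (0, y)) ∘L ContinuousLinearMap.inr ℝ ℝ E) y :=
      hφ'.hasFDerivAt.comp y (hl 0 y)
    have h2 := h1.clm_apply (hasFDerivAt_const ((1 : ℝ), (0 : E)) y)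
    rw [h2.fderiv]
    simp
  have hg (i : Fin k) : HasFDerivAt (fun t : ℝ => fderiv ℝ φ (t, y) (0, v i))
      (((fderiv ℝ (fderiv ℝ φ) (0, y)) ∘L ContinuousLinearMap.inl ℝ ℝ E).flip (0, v i)) 0 := by
    have h1 : HasFDerivAt (fun t : ℝ => fderiv ℝ φ (t, y))
      ((fderiv ℝ (fderiv ℝ φ) (0, y)) ∘L ContinuousLinearMap.inl ℝ ℝ E) 0 :=
      hφ'.hasFDerivAt.comp 0 (hr 0 y)
    have h2 := h1.clm_apply (hasFDerivAt_const ((0 : ℝ), v i) (0 : ℝ))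
    simpa using h2
  have hf : HasFDerivAt (fun t : ℝ => τ (φ (t, y)))
      (fderiv ℝ τ y ∘L fderiv ℝ φ (0, y) ∘L ContinuousLinearMap.inl ℝ ℝ E) 0 := by
    refine HasFDerivAt.comp (g := τ) (0 : ℝ) ?_ (hd.self_of_nhds.hasFDerivAt.comp 0 (hr 0 y))
    change HasFDerivAt τ _ (φ (0, y))
    rw [hy]
    exact hτ.hasFDerivAt
  -- The pullback evaluated on `v`. Its derivative at `t = 0` is computed by the product rule; no
  -- flow property of `φ` is needed.
  have hconst : (fun t : ℝ => τ (φ (t, y)) (fun i => fderiv ℝ φ (t, y) (0, v i))) =ᶠ[nhds 0]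
      fun _ => τ y v := by
    have hd' : ∀ᶠ t in nhds (0 : ℝ), DifferentiableAt ℝ φ (t, y) :=
      (hr 0 y).continuousAt.eventually hd
    filter_upwards [hinv, hd'] with t ht hdt
    rw [← ht, hslice t hdt]
    rfl
  have hder := (hf.continuousAlternatingMap_apply hg).fderiv
  rw [hconst.fderiv_eq, fderiv_fun_const] at hder
  have hv (i : Fin k) : fderiv ℝ φ (0, y) (0, v i) = v i := DFunLike.congr_fun hid (v i)
  -- Interchanging the mixed derivatives turns the `t`-derivative of `D_z φ` into the derivative of
  -- the velocity field.
  have hsymm (i : Fin k) : fderiv ℝ (fderiv ℝ φ) (0, y) (1, 0) (0, v i) =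
      fderiv ℝ (fderiv ℝ φ) (0, y) (0, v i) (1, 0) :=
    hφ.isSymmSndFDerivAt (by simp) _ _
  have h1 := DFunLike.congr_fun hder (1 : ℝ)
  simp only [hy, hv] at h1
  simp only [add_apply, ContinuousLinearMap.comp_apply,
    sum_apply, ContinuousLinearMap.flip_apply, ContinuousLinearMap.inl_apply,
    hsymm] at h1
  rw [coordLieDeriv, hX]
  exact h1.symm

end LocalCalculus

/-! ### Forms, vector fields and Lie derivatives in charts -/

section ChartFields
variable {E : Type*} [NormedAddCommGroup E] [NormedSpace ℝ E]
  {M : Type*} [TopologicalSpace M] [ChartedSpace E M]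

/-- The expression of a vector field in the chart at `x₀`. -/
def chartField (x₀ : M) (X : ∀ x : M, TangentSpace 𝓘(ℝ, E) x) (y : E) : E :=
  mfderiv 𝓘(ℝ, E) 𝓘(ℝ, E) (extChartAt 𝓘(ℝ, E) x₀)
    ((extChartAt 𝓘(ℝ, E) x₀).symm y) (X ((extChartAt 𝓘(ℝ, E) x₀).symm y))

/-- All tangent spaces are copies of `E`, so values at equal base points can be compared on the same
vectors without transport. This handles points such as `chart.symm (chart x)`. -/
theorem form_apply_congr {k : ℕ} (α : ∀ x : M, TangentSpace 𝓘(ℝ, E) x [⋀^Fin k]→L[ℝ] ℝ)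
    {p q : M} (h : p = q) (w : Fin k → E) : α p w = α q w := by
  subst h
  rfl

variable [IsManifold 𝓘(ℝ, E) ∞ M]

theorem mfderiv_chart_self (x : M) (v : E) :
    mfderiv 𝓘(ℝ, E) 𝓘(ℝ, E) (extChartAt 𝓘(ℝ, E) x) x v = v := by
  rw [mfderiv_extChartAt_self]
  rfl

theorem mfderiv_chart_symm_self (x : M) (v : E) :
    mfderiv 𝓘(ℝ, E) 𝓘(ℝ, E) (extChartAt 𝓘(ℝ, E) x).symm (extChartAt 𝓘(ℝ, E) x x) v = v := by
  have h := mfderivWithin_range_extChartAt_symm (I := 𝓘(ℝ, E)) (x := x)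
  rw [ModelWithCorners.range_eq_univ, mfderivWithin_univ] at h
  exact DFunLike.congr_fun h v

theorem mfderiv_chart_symm_mfderiv_chart (x₀ : M) {y : E}
    (hy : y ∈ (extChartAt 𝓘(ℝ, E) x₀).target) (v : E) :
    mfderiv 𝓘(ℝ, E) 𝓘(ℝ, E) (extChartAt 𝓘(ℝ, E) x₀).symm y
      (mfderiv 𝓘(ℝ, E) 𝓘(ℝ, E) (extChartAt 𝓘(ℝ, E) x₀)
        ((extChartAt 𝓘(ℝ, E) x₀).symm y) v) = v := by
  have h := mfderivWithin_extChartAt_symm_comp_mfderiv_extChartAt (I := 𝓘(ℝ, E)) hy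
  rw [ModelWithCorners.range_eq_univ, mfderivWithin_univ] at h
  exact DFunLike.congr_fun h v

theorem chartRep_self {k : ℕ} (α : ∀ x : M, TangentSpace 𝓘(ℝ, E) x [⋀^Fin k]→L[ℝ] ℝ) (x : M)
    (v : Fin k → E) : chartRep x α (extChartAt 𝓘(ℝ, E) x x) v = α x v := by
  refine (form_apply_congr α (extChartAt_to_inv x) _).trans ?_
  exact congrArg (α x) (funext fun i => mfderiv_chart_symm_self x (v i))

theorem chartField_self (X : ∀ x : M, TangentSpace 𝓘(ℝ, E) x) (x : M) :
    chartField x X (extChartAt 𝓘(ℝ, E) x x) = X x := by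
  have aux : ∀ p : M, p = x → (mfderiv 𝓘(ℝ, E) 𝓘(ℝ, E) (extChartAt 𝓘(ℝ, E) x) p (X p) : E) =
      X x := by
    rintro p rfl
    exact mfderiv_chart_self (E := E) p (X p)
  exact aux _ (extChartAt_to_inv x)

/-- The chart at `x` has identity derivative at `x`, so its representative there has the same values
as the form. Identities of forms thus reduce to pointwise identities at the centre of each chart. -/
theorem diffForm_ext {k : ℕ} {α β : DiffForm E M k}
    (h : ∀ (x : M) (v : Fin k → E), chartRep x α.1 (extChartAt 𝓘(ℝ, E) x x) v =
      chartRep x β.1 (extChartAt 𝓘(ℝ, E) x x) v) : α = β := by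
  refine Subtype.ext (funext fun x => ContinuousAlternatingMap.ext fun v => ?_)
  exact (chartRep_self α.1 x v).symm.trans ((h x v).trans (chartRep_self β.1 x v))

theorem differentiableAt_chartField (X : VField E M) (x₀ : M) {y : E}
    (hy : y ∈ (extChartAt 𝓘(ℝ, E) x₀).target) : DifferentiableAt ℝ (chartField x₀ X) y :=
  ((contDiffOn_vectorField X x₀).contDiffAt (target_mem_nhds x₀ hy)).differentiableAt (by simp)

theorem chartRep_interior {k : ℕ} (X : VField E M) (α : DiffForm E M (k + 1)) (x₀ : M) {y : E}
    (hy : y ∈ (extChartAt 𝓘(ℝ, E) x₀).target) :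
    chartRep x₀ (interior k X α).1 y = (chartRep x₀ α.1 y).curryLeft (chartField x₀ X y) :=
  chartRep_interiorAt X α.1 x₀ hy

theorem chartRep_interior_eventuallyEq {k : ℕ} (X : VField E M) (α : DiffForm E M (k + 1))
    (x₀ : M) {y : E} (hy : y ∈ (extChartAt 𝓘(ℝ, E) x₀).target) :
    chartRep x₀ (interior k X α).1 =ᶠ[nhds y]
      fun z => (chartRep x₀ α.1 z).curryLeft (chartField x₀ X z) := by
  filter_upwards [target_mem_nhds x₀ hy] with z hz using chartRep_interior X α x₀ hz

/-- Both `d` and the interior product are computed by the flat formulas in every chart, so the flat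
Cartan formula applies. It trades the definition of `lieDer` for one suited to derivatives of
pullbacks and to commutators. -/
theorem chartRep_lieDer {k : ℕ} (X : VField E M) (α : DiffForm E M k) (x₀ : M) {y : E}
    (hy : y ∈ (extChartAt 𝓘(ℝ, E) x₀).target) (v : Fin k → E) :
    chartRep x₀ (lieDer k X α).1 y v =
      coordLieDeriv (chartField x₀ X) (chartRep x₀ α.1) y v := by
  cases k with
  | zero =>
    rw [← extDeriv_vecCons_zero, ← chartRep_extDerivAt α x₀ hy]
    exact DFunLike.congr_fun (chartRep_interior X (extDer 0 α) x₀ hy) v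
  | succ k =>
    rw [← extDeriv_curryLeft_add (differentiableAt_chartRep α x₀ hy)
      (differentiableAt_chartField X x₀ hy), ← chartRep_extDerivAt α x₀ hy,
      ← (chartRep_interior_eventuallyEq X α x₀ hy).extDeriv_eq,
      ← chartRep_extDerivAt (interior k X α) x₀ hy]
    exact congrArg _ (DFunLike.congr_fun (chartRep_interior X (extDer (k + 1) α) x₀ hy) v)

theorem coordLieDeriv_congr {k : ℕ} {X Y : E → E} {τ σ : E → E [⋀^Fin k]→L[ℝ] ℝ} {y : E}
    (hX : X =ᶠ[nhds y] Y) (hτ : τ =ᶠ[nhds y] σ) (v : Fin k → E) :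
    coordLieDeriv X τ y v = coordLieDeriv Y σ y v := by
  rw [coordLieDeriv, coordLieDeriv, hX.fderiv_eq, hτ.fderiv_eq, hX.self_of_nhds, hτ.self_of_nhds]

/-- The commutator of a Lie derivative with an interior product. -/
theorem lieDer_interior {k : ℕ} {X Y Z : VField E M} (α : DiffForm E M (k + 1))
    (hZ : ∀ x : M, VectorField.lieBracket ℝ (chartField x X) (chartField x Y)
      (extChartAt 𝓘(ℝ, E) x x) = Z x) :
    lieDer k X (interior k Y α) = interior k Y (lieDer (k + 1) X α) + interior k Z α := by
  refine diffForm_ext fun x v => ?_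
  have hx := mem_extChartAt_target (I := 𝓘(ℝ, E)) x
  rw [chartRep_lieDer _ _ _ hx,
    coordLieDeriv_congr Filter.EventuallyEq.rfl (chartRep_interior_eventuallyEq Y α x hx),
    coordLieDeriv_curryLeft (differentiableAt_chartRep α x hx) (differentiableAt_chartField Y x hx),
    ← chartRep_lieDer _ _ _ hx, hZ, ← chartField_self Z x]
  change _ = chartRep x (interior k Y (lieDer (k + 1) X α)).1 _ v +
    chartRep x (interior k Z α).1 _ v
  rw [chartRep_interior _ _ _ hx, chartRep_interior _ _ _ hx]
  rfl

theorem interior_interior_self {k : ℕ} (X : VField E M) (α : DiffForm E M (k + 2)) :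
    interior k X (interior (k + 1) X α) = 0 :=
  Subtype.ext (funext fun x => ContinuousAlternatingMap.curryLeft_same (E := E) (α.1 x) (X x))

/-- Pulling back along the inverse chart applies the inverse of its derivative, which is the
derivative of the chart. This links `chartField` to the bracket `mlieBracket` used for the Lie
algebra of `G`. -/
theorem mpullbackWithin_eq_chartField (X : ∀ x : M, TangentSpace 𝓘(ℝ, E) x) (x₀ : M) {y : E}
    (hy : y ∈ (extChartAt 𝓘(ℝ, E) x₀).target) :
    VectorField.mpullbackWithin 𝓘(ℝ, E) 𝓘(ℝ, E) (extChartAt 𝓘(ℝ, E) x₀).symm X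
      (Set.range 𝓘(ℝ, E)) y = chartField x₀ X y := by
  have h := ContinuousLinearMap.inverse_eq
    (mfderivWithin_extChartAt_symm_comp_mfderiv_extChartAt (I := 𝓘(ℝ, E)) hy)
    (mfderiv_extChartAt_comp_mfderivWithin_extChartAt_symm (I := 𝓘(ℝ, E)) hy)
  exact DFunLike.congr_fun h _

theorem mpullbackWithin_eventuallyEq_chartField (X : ∀ x : M, TangentSpace 𝓘(ℝ, E) x) (x : M) :
    VectorField.mpullbackWithin 𝓘(ℝ, E) 𝓘(ℝ, E) (extChartAt 𝓘(ℝ, E) x).symm X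
      (Set.range 𝓘(ℝ, E)) =ᶠ[nhds (extChartAt 𝓘(ℝ, E) x x)] chartField x X := by
  filter_upwards [target_mem_nhds x (mem_extChartAt_target (I := 𝓘(ℝ, E)) x)] with z hz
  exact mpullbackWithin_eq_chartField X x hz

theorem mlieBracket_eq_lieBracket_chartField (X Y : ∀ x : M, TangentSpace 𝓘(ℝ, E) x) (x : M) :
    VectorField.mlieBracket 𝓘(ℝ, E) X Y x =
      VectorField.lieBracket ℝ (chartField x X) (chartField x Y) (extChartAt 𝓘(ℝ, E) x x) := by
  rw [← (mpullbackWithin_eventuallyEq_chartField X x).lieBracket_vectorField_eq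
    (mpullbackWithin_eventuallyEq_chartField Y x), ← VectorField.mlieBracketWithin_univ,
    VectorField.mlieBracketWithin_apply]
  -- The bracket is taken in the chart and carried back to `x` by the inverse of the chart's
  -- derivative at its own centre, which is the identity.
  have hinv (A : E →L[ℝ] E) (hA : A = ContinuousLinearMap.id ℝ E) (w : E) : A.inverse w = w := by
    rw [hA, ContinuousLinearMap.inverse_id]
    rfl
  refine (hinv _ mfderiv_extChartAt_self _).trans ?_
  rw [Set.preimage_univ, Set.univ_inter]
  refine VectorField.lieBracketWithin_of_mem_nhds ?_
  rw [ModelWithCorners.range_eq_univ]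
  exact Filter.univ_mem

theorem differentiableAt_chartField_of_mdifferentiableAt [CompleteSpace E]
    {X : ∀ x : M, TangentSpace 𝓘(ℝ, E) x} {x : M}
    (hX : MDifferentiableAt 𝓘(ℝ, E) 𝓘(ℝ, E).tangent
      (fun x => (⟨x, X x⟩ : TangentBundle 𝓘(ℝ, E) M)) x) :
    DifferentiableAt ℝ (chartField x X) (extChartAt 𝓘(ℝ, E) x x) := by
  have : IsManifold 𝓘(ℝ, E) 3 M := IsManifold.of_le (n := ∞) ENat.LEInfty.out
  have h := (mdifferentiableWithinAt_univ.2
    hX).differentiableWithinAt_mpullbackWithin_vectorField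
  refine (mpullbackWithin_eventuallyEq_chartField X x).differentiableAt_iff.1
    (DifferentiableWithinAt.differentiableAt h ?_)
  rw [Set.preimage_univ, Set.univ_inter, ModelWithCorners.range_eq_univ]
  exact Filter.univ_mem

end ChartFields

/-! ### Orbit maps and the infinitesimal action -/

section GroupAction
variable {E : Type*} [NormedAddCommGroup E] [NormedSpace ℝ E]
  {M : Type*} [TopologicalSpace M] [ChartedSpace E M]
  {F : Type*} [NormedAddCommGroup F] [NormedSpace ℝ F]
  {G : Type*} [TopologicalSpace G] [ChartedSpace F G]

theorem mfderiv_apply_congr {f f' : G → M} (h : f = f') (g : G) (ξ : F) :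
    (mfderiv 𝓘(ℝ, F) 𝓘(ℝ, E) f g ξ : E) = mfderiv 𝓘(ℝ, F) 𝓘(ℝ, E) f' g ξ := by
  subst h
  rfl

theorem mfderiv_apply_congr_point (f : G → M) {g g' : G} (h : g = g') (ξ : F) :
    (mfderiv 𝓘(ℝ, F) 𝓘(ℝ, E) f g ξ : E) = mfderiv 𝓘(ℝ, F) 𝓘(ℝ, E) f g' ξ := by
  subst h
  rfl

theorem contMDiff_translation [SMul G M]
    (h : ContMDiff (𝓘(ℝ, F).prod 𝓘(ℝ, E)) 𝓘(ℝ, E) ∞ (fun p : G × M => p.1 • p.2)) (g : G) :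
    ContMDiff 𝓘(ℝ, E) 𝓘(ℝ, E) ∞ (fun x : M => g • x) :=
  h.comp (contMDiff_const.prodMk contMDiff_id)

theorem mulInvariantVectorField_one [Group G] (ξ : F) :
    (mulInvariantVectorField (I := 𝓘(ℝ, F)) (G := G) ξ 1 : F) = ξ := by
  have e : (fun h : G => 1 * h) = id := by funext h; simp
  refine (mfderiv_apply_congr e 1 ξ).trans ?_
  rw [mfderiv_id]
  rfl

variable [Group G] [MulAction G M] [ContMDiffSMul 𝓘(ℝ, F) 𝓘(ℝ, E) ∞ G M]

variable (E M F G) in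
theorem contMDiff_action : ContMDiff (𝓘(ℝ, F).prod 𝓘(ℝ, E)) 𝓘(ℝ, E) ∞
    (fun p : G × M => p.1 • p.2) :=
  ContMDiffSMul.contMDiff_smul

variable (E F) in
theorem contMDiff_orbit (z : M) : ContMDiff 𝓘(ℝ, F) 𝓘(ℝ, E) ∞ (fun g : G => g • z) :=
  (contMDiff_action E M F G).comp (contMDiff_id.prodMk contMDiff_const)

variable [LieGroup 𝓘(ℝ, F) ∞ G]

variable (E F) in
theorem contMDiff_inv_smul (z : M) :
    ContMDiff 𝓘(ℝ, F) 𝓘(ℝ, E) ∞ (fun g : G => g⁻¹ • z) :=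
  (contMDiff_action E M F G).comp ((contMDiff_inv 𝓘(ℝ, F) ∞).prodMk contMDiff_const)

/-- The map `(g, h) ↦ (g⁻¹ h) • z` is constant on the diagonal, so its two partial derivatives at
`(1, 1)` along `ξ` add up to zero. -/
theorem mfderiv_inv_smul (z : M) (ξ : F) :
    (mfderiv 𝓘(ℝ, F) 𝓘(ℝ, E) (fun g : G => g⁻¹ • z) 1 ξ : E) =
      -(infGenAt E F G z ξ : E) := by
  let P : G × G → M := fun p => (p.1⁻¹ * p.2) • z
  have hP : ContMDiff (𝓘(ℝ, F).prod 𝓘(ℝ, F)) 𝓘(ℝ, E) ∞ P :=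
    (contMDiff_action E M F G).comp
      ((((contMDiff_inv 𝓘(ℝ, F) ∞).comp contMDiff_fst).mul contMDiff_snd).prodMk contMDiff_const)
  have hP' := hP.mdifferentiableAt (x := ((1 : G), (1 : G))) (by simp)
  have hdiag : HasMFDerivAt 𝓘(ℝ, F) (𝓘(ℝ, F).prod 𝓘(ℝ, F)) (fun g : G => (g, g)) 1
      ((ContinuousLinearMap.id ℝ F).prod (ContinuousLinearMap.id ℝ F)) :=
    (hasMFDerivAt_id (1 : G)).prodMk (hasMFDerivAt_id (1 : G))
  have h1 := HasMFDerivAt.comp (f := fun g : G => (g, g)) (g := P) (1 : G) hP'.hasMFDerivAt hdiag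
  have hconst : P ∘ (fun g : G => (g, g)) = fun _ => z := by
    funext g
    simp [P]
  rw [hconst] at h1
  have h0 := hasMFDerivAt_unique h1 (hasMFDerivAt_const z (1 : G))
  have h2 : (mfderiv (𝓘(ℝ, F).prod 𝓘(ℝ, F)) 𝓘(ℝ, E) P ((1 : G), (1 : G)) (ξ, ξ) : E) = 0 :=
    DFunLike.congr_fun h0 ξ
  have hsum := mfderiv_prod_eq_add_apply (I := 𝓘(ℝ, F)) (I' := 𝓘(ℝ, F)) (I'' := 𝓘(ℝ, E))
    (p := ((1 : G), (1 : G))) (v := ((ξ : TangentSpace 𝓘(ℝ, F) (1 : G)),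
      (ξ : TangentSpace 𝓘(ℝ, F) (1 : G)))) hP'
  have h3 : (0 : E) = mfderiv 𝓘(ℝ, F) 𝓘(ℝ, E) (fun g : G => P (g, 1)) 1 ξ +
      mfderiv 𝓘(ℝ, F) 𝓘(ℝ, E) (fun g : G => P (1, g)) 1 ξ := h2.symm.trans hsum
  have e1 : (fun g : G => P (g, 1)) = fun g => g⁻¹ • z := by funext g; simp [P]
  have e2 : (fun g : G => P (1, g)) = fun g => g • z := by funext g; simp [P]
  exact eq_neg_of_add_eq_zero_left (h3.trans (congrArg₂ (fun a b : E => a + b)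
    (mfderiv_apply_congr e1 1 ξ) (mfderiv_apply_congr e2 1 ξ))).symm

/-- The left invariant field of `ξ` and the field `-V_ξ` are related by `g ↦ g⁻¹ • z`. -/
theorem mfderiv_inv_smul_mulInvariantVectorField (z : M) (ξ : F) (g : G) :
    (mfderiv 𝓘(ℝ, F) 𝓘(ℝ, E) (fun h : G => h⁻¹ • z) g
      (mulInvariantVectorField (I := 𝓘(ℝ, F)) (G := G) ξ g) : E) =
      -(infGenAt E F G (g⁻¹ • z) ξ : E) := by
  have hmul : ContMDiff 𝓘(ℝ, F) 𝓘(ℝ, F) ∞ (fun h : G => g * h) := contMDiff_mul_left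
  -- The left invariant field at `g` is the image of `ξ` under `h ↦ g h`, and `(g h)⁻¹ • z = h⁻¹ •
  -- (g⁻¹ • z)`; this reduces to the derivative at `1` for the point `g⁻¹ • z`.
  have h1 := HasMFDerivAt.comp (1 : G)
    (((contMDiff_inv_smul E F z).mdifferentiableAt (by simp)).hasMFDerivAt (x := g * 1))
    (hmul.mdifferentiableAt (x := 1) (by simp)).hasMFDerivAt
  have e : (fun h : G => h⁻¹ • z) ∘ (fun h : G => g * h) = fun h : G => h⁻¹ • (g⁻¹ • z) := by
    funext h
    simp [mul_smul]
  rw [← mfderiv_inv_smul, ← mfderiv_apply_congr e 1 ξ, h1.mfderiv]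
  exact mfderiv_apply_congr_point (fun h : G => h⁻¹ • z) (mul_one g).symm _

end GroupAction

/-! ### Smooth maps and forms in a pair of charts -/

section ChartExpressions
variable {E : Type*} [NormedAddCommGroup E] [NormedSpace ℝ E]
  {M : Type*} [TopologicalSpace M] [ChartedSpace E M]
  {F : Type*} [NormedAddCommGroup F] [NormedSpace ℝ F]
  {N : Type*} [TopologicalSpace N] [ChartedSpace F N] [IsManifold 𝓘(ℝ, F) ∞ N]

theorem chartField_chart (X : ∀ x : M, TangentSpace 𝓘(ℝ, E) x) (x₀ : M) {z : M}
    (hz : z ∈ (extChartAt 𝓘(ℝ, E) x₀).source) :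
    chartField x₀ X (extChartAt 𝓘(ℝ, E) x₀ z) =
      mfderiv 𝓘(ℝ, E) 𝓘(ℝ, E) (extChartAt 𝓘(ℝ, E) x₀) z (X z) := by
  have aux : ∀ p : M, p = z → (mfderiv 𝓘(ℝ, E) 𝓘(ℝ, E) (extChartAt 𝓘(ℝ, E) x₀) p (X p) : E) =
      mfderiv 𝓘(ℝ, E) 𝓘(ℝ, E) (extChartAt 𝓘(ℝ, E) x₀) z (X z) := by
    rintro p rfl
    rfl
  exact aux _ ((extChartAt 𝓘(ℝ, E) x₀).left_inv hz)

variable [IsManifold 𝓘(ℝ, E) ∞ M]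

theorem contDiffAt_chart_expression {f : N → M} (hf : ContMDiff 𝓘(ℝ, F) 𝓘(ℝ, E) ∞ f) (p₀ : N)
    (x₀ : M) {s : F} (hs : s ∈ (extChartAt 𝓘(ℝ, F) p₀).target)
    (hfs : f ((extChartAt 𝓘(ℝ, F) p₀).symm s) ∈ (extChartAt 𝓘(ℝ, E) x₀).source) :
    ContDiffAt ℝ ∞
      (fun s => extChartAt 𝓘(ℝ, E) x₀ (f ((extChartAt 𝓘(ℝ, F) p₀).symm s))) s := by
  rw [← contMDiffAt_iff_contDiffAt]
  have h1 : ContMDiffAt 𝓘(ℝ, E) 𝓘(ℝ, E) ∞ (extChartAt 𝓘(ℝ, E) x₀)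
      (f ((extChartAt 𝓘(ℝ, F) p₀).symm s)) :=
    contMDiffAt_extChartAt' (by rwa [extChartAt_source] at hfs)
  have h2 : ContMDiffAt 𝓘(ℝ, F) 𝓘(ℝ, F) ∞ (extChartAt 𝓘(ℝ, F) p₀).symm s :=
    (contMDiffOn_extChartAt_symm p₀).contMDiffAt (target_mem_nhds p₀ hs)
  exact h1.comp s (hf.contMDiffAt.comp s h2)

theorem fderiv_chart_expression {f : N → M} (hf : ContMDiff 𝓘(ℝ, F) 𝓘(ℝ, E) ∞ f) (p₀ : N)
    (x₀ : M) {s : F} (hs : s ∈ (extChartAt 𝓘(ℝ, F) p₀).target)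
    (hfs : f ((extChartAt 𝓘(ℝ, F) p₀).symm s) ∈ (extChartAt 𝓘(ℝ, E) x₀).source) (u : F) :
    fderiv ℝ (fun s => extChartAt 𝓘(ℝ, E) x₀ (f ((extChartAt 𝓘(ℝ, F) p₀).symm s))) s u =
      mfderiv 𝓘(ℝ, E) 𝓘(ℝ, E) (extChartAt 𝓘(ℝ, E) x₀) (f ((extChartAt 𝓘(ℝ, F) p₀).symm s))
        (mfderiv 𝓘(ℝ, F) 𝓘(ℝ, E) f ((extChartAt 𝓘(ℝ, F) p₀).symm s)
          (mfderiv 𝓘(ℝ, F) 𝓘(ℝ, F) (extChartAt 𝓘(ℝ, F) p₀).symm s u)) := by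
  have h1 : MDifferentiableAt 𝓘(ℝ, E) 𝓘(ℝ, E) (extChartAt 𝓘(ℝ, E) x₀)
      (f ((extChartAt 𝓘(ℝ, F) p₀).symm s)) :=
    mdifferentiableAt_extChartAt (by rwa [extChartAt_source] at hfs)
  have h2 : MDifferentiableAt 𝓘(ℝ, F) 𝓘(ℝ, E) f ((extChartAt 𝓘(ℝ, F) p₀).symm s) :=
    hf.mdifferentiableAt (by simp)
  have h3 := h1.hasMFDerivAt.comp s (h2.hasMFDerivAt.comp s
    (mdifferentiableAt_symm p₀ hs).hasMFDerivAt)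
  rw [← mfderiv_eq_fderiv]
  exact DFunLike.congr_fun h3.mfderiv u

/-- The derivatives of the chart and of its inverse cancel. Unlike `chartRep_self`, this applies
away from the centre, as needed at the translated points `g • x`. -/
theorem chartRep_chart {k : ℕ} (α : ∀ x : M, TangentSpace 𝓘(ℝ, E) x [⋀^Fin k]→L[ℝ] ℝ) (x₀ : M)
    {z : M} (hz : z ∈ (extChartAt 𝓘(ℝ, E) x₀).source) (w : Fin k → E) :
    chartRep x₀ α (extChartAt 𝓘(ℝ, E) x₀ z) (fun i =>
      mfderiv 𝓘(ℝ, E) 𝓘(ℝ, E) (extChartAt 𝓘(ℝ, E) x₀) z (w i)) = α z w := by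
  have hy := (extChartAt 𝓘(ℝ, E) x₀).map_source hz
  have hinv := (extChartAt 𝓘(ℝ, E) x₀).left_inv hz
  have aux : ∀ p : M, p = z → ∀ v : E,
      (mfderiv 𝓘(ℝ, E) 𝓘(ℝ, E) (extChartAt 𝓘(ℝ, E) x₀) z v : E) =
        mfderiv 𝓘(ℝ, E) 𝓘(ℝ, E) (extChartAt 𝓘(ℝ, E) x₀) p v := by
    rintro p rfl v
    rfl
  refine Eq.trans ?_ (form_apply_congr α hinv w)
  refine congrArg (α _) (funext fun i => ?_)
  refine Eq.trans ?_ (mfderiv_chart_symm_mfderiv_chart x₀ hy (w i))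
  exact congrArg (mfderiv 𝓘(ℝ, E) 𝓘(ℝ, E) (extChartAt 𝓘(ℝ, E) x₀).symm _) (aux _ hinv (w i))

end ChartExpressions

/-! ### Brackets of infinitesimal generators -/

section Bracket
variable {E : Type*} [NormedAddCommGroup E] [NormedSpace ℝ E]
  {M : Type*} [TopologicalSpace M] [ChartedSpace E M]
  {F : Type*} [NormedAddCommGroup F] [NormedSpace ℝ F]
  {G : Type*} [TopologicalSpace G] [ChartedSpace F G] [Group G] [LieGroup 𝓘(ℝ, F) ∞ G]
  [MulAction G M] [ContMDiffSMul 𝓘(ℝ, F) 𝓘(ℝ, E) ∞ G M]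

theorem eventually_inv_smul_mem_source (x : M) :
    ∀ᶠ s in nhds (extChartAt 𝓘(ℝ, F) (1 : G) 1), s ∈ (extChartAt 𝓘(ℝ, F) (1 : G)).target ∧
      ((extChartAt 𝓘(ℝ, F) (1 : G)).symm s)⁻¹ • x ∈ (extChartAt 𝓘(ℝ, E) x).source := by
  have h1 := mem_extChartAt_target (I := 𝓘(ℝ, F)) (1 : G)
  refine Filter.Eventually.and (target_mem_nhds (1 : G) h1) ?_
  have hc : ContinuousAt (fun s => ((extChartAt 𝓘(ℝ, F) (1 : G)).symm s)⁻¹ • x)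
      (extChartAt 𝓘(ℝ, F) (1 : G) 1) :=
    ContinuousAt.comp (g := fun g : G => g⁻¹ • x) (contMDiff_inv_smul E F x).continuous.continuousAt
      (mdifferentiableAt_symm (1 : G) h1).continuousAt
  refine hc.eventually ((isOpen_extChartAt_source x).mem_nhds ?_)
  change ((extChartAt 𝓘(ℝ, F) (1 : G)).symm (extChartAt 𝓘(ℝ, F) (1 : G) 1))⁻¹ • x ∈ _
  rw [extChartAt_to_inv, inv_one, one_smul]
  exact mem_extChartAt_source x

variable [IsManifold 𝓘(ℝ, E) ∞ M]

/-- The relation `mfderiv_inv_smul_mulInvariantVectorField` read in charts. Using `g⁻¹ • x` rather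
than `g • x` makes the left invariant fields, which define the bracket of the Lie algebra, related
to generators of the action. -/
theorem fderiv_inv_smul_chartField (x : M) (ξ : F) {s : F}
    (hs : s ∈ (extChartAt 𝓘(ℝ, F) (1 : G)).target ∧
      ((extChartAt 𝓘(ℝ, F) (1 : G)).symm s)⁻¹ • x ∈ (extChartAt 𝓘(ℝ, E) x).source) :
    fderiv ℝ (fun s => extChartAt 𝓘(ℝ, E) x (((extChartAt 𝓘(ℝ, F) (1 : G)).symm s)⁻¹ • x)) s
      (chartField (1 : G) (mulInvariantVectorField (I := 𝓘(ℝ, F)) (G := G) ξ) s) =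
    -chartField x (infGen E M F G ξ)
      (extChartAt 𝓘(ℝ, E) x (((extChartAt 𝓘(ℝ, F) (1 : G)).symm s)⁻¹ • x)) := by
  refine (fderiv_chart_expression (contMDiff_inv_smul E F x) (1 : G) x hs.1 hs.2 _).trans ?_
  rw [chartField_chart _ x hs.2]
  refine Eq.trans ?_ (map_neg (mfderiv 𝓘(ℝ, E) 𝓘(ℝ, E) (extChartAt 𝓘(ℝ, E) x) _) _)
  refine congrArg _ ?_
  refine Eq.trans ?_ (mfderiv_inv_smul_mulInvariantVectorField (E := E) x ξ _)
  exact congrArg _ (mfderiv_chart_symm_mfderiv_chart (1 : G) hs.1 _)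

theorem lieBracket_neg_neg (X Y : E → E) (y : E) :
    VectorField.lieBracket ℝ (fun z => -X z) (fun z => -Y z) y =
      VectorField.lieBracket ℝ X Y y := by
  simp [VectorField.lieBracket, fderiv_fun_neg]

/-- The infinitesimal generators satisfy `[V_ξ, V_η] = -V_[ξ, η]`. -/
theorem lieBracket_chartField_infGen [CompleteSpace F] (x : M)
    (ξ η : GroupLieAlgebra 𝓘(ℝ, F) G) :
    VectorField.lieBracket ℝ (chartField x (infGen E M F G ξ)) (chartField x (infGen E M F G η))
      (extChartAt 𝓘(ℝ, E) x x) = infGen E M F G (-⁅ξ, η⁆) x := by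
  have hev := eventually_inv_smul_mem_source (E := E) (F := F) (G := G) x
  set a := extChartAt 𝓘(ℝ, F) (1 : G) 1 with ha
  have hfa : extChartAt 𝓘(ℝ, E) x (((extChartAt 𝓘(ℝ, F) (1 : G)).symm a)⁻¹ • x) =
      extChartAt 𝓘(ℝ, E) x x := by
    rw [ha, extChartAt_to_inv, inv_one, one_smul]
  have hx := mem_extChartAt_target (I := 𝓘(ℝ, E)) x
  -- Left invariant fields are related to `-V_ξ` and `-V_η`, hence so are their brackets.
  have hrel := fderiv_lieBracket_of_related
    (f := fun s => extChartAt 𝓘(ℝ, E) x (((extChartAt 𝓘(ℝ, F) (1 : G)).symm s)⁻¹ • x)) (a := a)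
    (V := chartField (1 : G) (mulInvariantVectorField (I := 𝓘(ℝ, F)) (G := G) ξ))
    (W := chartField (1 : G) (mulInvariantVectorField (I := 𝓘(ℝ, F)) (G := G) η))
    (X := fun z => -chartField x (infGen E M F G ξ) z)
    (Y := fun z => -chartField x (infGen E M F G η) z)
    ((contDiffAt_chart_expression (contMDiff_inv_smul E F x) (1 : G) x hev.self_of_nhds.1
      hev.self_of_nhds.2).of_le ENat.LEInfty.out)
    (differentiableAt_chartField_of_mdifferentiableAt (E := F)
      (mdifferentiableAt_mulInvariantVectorField (I := 𝓘(ℝ, F)) (G := G) ξ))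
    (differentiableAt_chartField_of_mdifferentiableAt (E := F)
      (mdifferentiableAt_mulInvariantVectorField (I := 𝓘(ℝ, F)) (G := G) η))
    (by rw [hfa]; exact (differentiableAt_chartField _ x hx).neg)
    (by rw [hfa]; exact (differentiableAt_chartField _ x hx).neg)
    (hev.mono fun s hs => fderiv_inv_smul_chartField (F := F) x ξ hs)
    (hev.mono fun s hs => fderiv_inv_smul_chartField (F := F) x η hs)
  -- The bracket of the Lie algebra is the value at `1` of the bracket of the left invariant fields.
  have hbr : VectorField.lieBracket ℝ
      (chartField (1 : G) (mulInvariantVectorField (I := 𝓘(ℝ, F)) (G := G) ξ))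
      (chartField (1 : G) (mulInvariantVectorField (I := 𝓘(ℝ, F)) (G := G) η)) a =
      chartField (1 : G) (mulInvariantVectorField (I := 𝓘(ℝ, F)) (G := G) ⁅ξ, η⁆) a := by
    rw [ha, ← mlieBracket_eq_lieBracket_chartField, chartField_self]
    exact (mulInvariantVectorField_one _).symm
  -- The signs cancel in `[-V_ξ, -V_η]`, but one remains in the image of the field of `⁅ξ, η⁆`;
  -- hence the minus sign in the result.
  rw [hbr, lieBracket_neg_neg, hfa] at hrel
  rw [← hrel]
  refine (fderiv_inv_smul_chartField (F := F) x
    (⁅ξ, η⁆ : GroupLieAlgebra 𝓘(ℝ, F) G) hev.self_of_nhds).trans ?_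
  rw [hfa, chartField_self, map_neg]
  rfl

end Bracket

/-! ### Invariant forms have zero Lie derivative -/

section Invariance
variable {E : Type*} [NormedAddCommGroup E] [NormedSpace ℝ E]
  {M : Type*} [TopologicalSpace M] [ChartedSpace E M] [IsManifold 𝓘(ℝ, E) ∞ M]
  {F : Type*} [NormedAddCommGroup F] [NormedSpace ℝ F]
  {G : Type*} [TopologicalSpace G] [ChartedSpace F G] [Group G] [LieGroup 𝓘(ℝ, F) ∞ G]
  [MulAction G M] [ContMDiffSMul 𝓘(ℝ, F) 𝓘(ℝ, E) ∞ G M]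

variable (E F G) in
/-- In the chart at `x`, the translations by the elements of a curve in `G` that starts at `1` with
velocity `ξ`. -/
def translationFamily (x : M) (ξ : F) (p : ℝ × E) : E :=
  extChartAt 𝓘(ℝ, E) x ((extChartAt 𝓘(ℝ, F) (1 : G)).symm
    (extChartAt 𝓘(ℝ, F) (1 : G) 1 + p.1 • ξ) • (extChartAt 𝓘(ℝ, E) x).symm p.2)

theorem contDiffAt_translationFamily (x : M) (ξ : F) {z : E}
    (hz : z ∈ (extChartAt 𝓘(ℝ, E) x).target) :
    ContDiffAt ℝ ∞ (translationFamily E F G x ξ) (0, z) := by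
  rw [← contMDiffAt_iff_contDiffAt]
  have hsym : ContMDiffAt 𝓘(ℝ, F) 𝓘(ℝ, F) ∞ (extChartAt 𝓘(ℝ, F) (1 : G)).symm
      (extChartAt 𝓘(ℝ, F) (1 : G) 1 + (0 : ℝ) • ξ) := by
    rw [zero_smul, add_zero]
    exact (contMDiffOn_extChartAt_symm (1 : G)).contMDiffAt
      (target_mem_nhds (1 : G) (mem_extChartAt_target (1 : G)))
  have hline : ContMDiffAt 𝓘(ℝ, ℝ × E) 𝓘(ℝ, F) ∞
      (fun p : ℝ × E => extChartAt 𝓘(ℝ, F) (1 : G) 1 + p.1 • ξ) (0, z) :=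
    (contDiff_const.add (contDiff_fst.smul contDiff_const)).contMDiff.contMDiffAt
  have h1 : ContMDiffAt 𝓘(ℝ, ℝ × E) 𝓘(ℝ, F) ∞ (fun p : ℝ × E =>
      (extChartAt 𝓘(ℝ, F) (1 : G)).symm (extChartAt 𝓘(ℝ, F) (1 : G) 1 + p.1 • ξ)) (0, z) :=
    ContMDiffAt.comp (g := (extChartAt 𝓘(ℝ, F) (1 : G)).symm) ((0 : ℝ), z) hsym hline
  have h2 : ContMDiffAt 𝓘(ℝ, ℝ × E) 𝓘(ℝ, E) ∞
      (fun p : ℝ × E => (extChartAt 𝓘(ℝ, E) x).symm p.2) (0, z) :=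
    ContMDiffAt.comp (g := (extChartAt 𝓘(ℝ, E) x).symm) ((0 : ℝ), z)
      ((contMDiffOn_extChartAt_symm x).contMDiffAt (target_mem_nhds x hz))
      (contDiff_snd (𝕜 := ℝ) (E := ℝ) (F := E)).contMDiff.contMDiffAt
  have h3 := ContMDiffAt.comp (g := fun p : G × M => p.1 • p.2) ((0 : ℝ), z)
    (contMDiff_action E M F G).contMDiffAt (h1.prodMk h2)
  have hsrc : (extChartAt 𝓘(ℝ, F) (1 : G)).symm (extChartAt 𝓘(ℝ, F) (1 : G) 1 + (0 : ℝ) • ξ) •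
      (extChartAt 𝓘(ℝ, E) x).symm z ∈ (chartAt E x).source := by
    rw [zero_smul, add_zero, extChartAt_to_inv, one_smul, ← extChartAt_source 𝓘(ℝ, E)]
    exact (extChartAt 𝓘(ℝ, E) x).map_target hz
  exact ContMDiffAt.comp (g := extChartAt 𝓘(ℝ, E) x) ((0 : ℝ), z) (contMDiffAt_extChartAt' hsrc) h3

/-- Only the velocity at `t = 0` matters, so a straight line in the chart at `1` replaces `exp (t
ξ)`; its velocity is `ξ` because that chart has identity derivative at `1`. -/
theorem fderiv_translationFamily (x : M) (ξ : F) {z : E}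
    (hz : z ∈ (extChartAt 𝓘(ℝ, E) x).target) :
    fderiv ℝ (translationFamily E F G x ξ) (0, z) (1, 0) =
      chartField x (infGen E M F G ξ) z := by
  set z' := (extChartAt 𝓘(ℝ, E) x).symm z with hz'
  set a := extChartAt 𝓘(ℝ, F) (1 : G) 1 with ha
  have hd := (contDiffAt_translationFamily (G := G) x ξ hz).differentiableAt (by simp)
  have h1 : HasFDerivAt (fun t : ℝ => translationFamily E F G x ξ (t, z))
      (fderiv ℝ (translationFamily E F G x ξ) (0, z) ∘L ContinuousLinearMap.inl ℝ ℝ E) 0 :=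
    HasFDerivAt.comp (f := fun t : ℝ => (t, z)) (0 : ℝ) hd.hasFDerivAt
      (hasFDerivAt_prodMk_left (0 : ℝ) z)
  have hs : a ∈ (extChartAt 𝓘(ℝ, F) (1 : G)).target := mem_extChartAt_target (1 : G)
  have hpt : (extChartAt 𝓘(ℝ, F) (1 : G)).symm a • z' = z' := by
    rw [ha, extChartAt_to_inv, one_smul]
  have hsrc : (extChartAt 𝓘(ℝ, F) (1 : G)).symm a • z' ∈ (extChartAt 𝓘(ℝ, E) x).source := by
    rw [hpt]
    exact (extChartAt 𝓘(ℝ, E) x).map_target hz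
  have hline : HasFDerivAt (fun t : ℝ => a + t • ξ)
      (ContinuousLinearMap.toSpanSingleton ℝ ξ) (0 : ℝ) :=
    (ContinuousLinearMap.toSpanSingleton ℝ ξ).hasFDerivAt.const_add a
  have hd2 : DifferentiableAt ℝ (fun s => extChartAt 𝓘(ℝ, E) x
      ((extChartAt 𝓘(ℝ, F) (1 : G)).symm s • z')) (a + (0 : ℝ) • ξ) := by
    rw [zero_smul, add_zero]
    exact (contDiffAt_chart_expression (contMDiff_orbit E F z') (1 : G) x hs
      hsrc).differentiableAt (by simp)
  have h2 := HasFDerivAt.comp (0 : ℝ) hd2.hasFDerivAt hline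
  have h3 := DFunLike.congr_fun (h1.unique h2) (1 : ℝ)
  refine h3.trans ?_
  change fderiv ℝ (fun s => extChartAt 𝓘(ℝ, E) x
      ((extChartAt 𝓘(ℝ, F) (1 : G)).symm s • z')) (a + (0 : ℝ) • ξ) ((1 : ℝ) • ξ) = _
  rw [zero_smul, add_zero, one_smul]
  refine (fderiv_chart_expression (contMDiff_orbit E F z') (1 : G) x hs hsrc ξ).trans ?_
  have aux : ∀ p : M, p = z' → ∀ v w : E, v = w →
      (mfderiv 𝓘(ℝ, E) 𝓘(ℝ, E) (extChartAt 𝓘(ℝ, E) x) p v : E) =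
        mfderiv 𝓘(ℝ, E) 𝓘(ℝ, E) (extChartAt 𝓘(ℝ, E) x) z' w := by
    rintro p rfl v w rfl
    rfl
  refine aux _ hpt _ _ ?_
  refine (mfderiv_apply_congr_point (fun g : G => g • z') (extChartAt_to_inv (1 : G)) _).trans ?_
  exact congrArg _ (mfderiv_chart_symm_self (1 : G) ξ)

/-- Forms that are preserved by the group have vanishing Lie derivatives. -/
theorem lieDer_infGen_eq_zero {k : ℕ} {Ω : DiffForm E M k} (hG : PreservesForm G Ω)
    (ξ : F) : lieDer k (infGen E M F G ξ) Ω = 0 := by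
  refine diffForm_ext fun x v => ?_
  have hx := mem_extChartAt_target (I := 𝓘(ℝ, E)) x
  set y := extChartAt 𝓘(ℝ, E) x x with hy
  set a := extChartAt 𝓘(ℝ, F) (1 : G) 1 with ha
  rw [chartRep_lieDer _ _ _ hx]
  -- The chart representative of the zero form is zero by definition.
  refine Eq.trans ?_ (rfl : (0 : ℝ) = _)
  have hX : chartField x (infGen E M F G ξ) =ᶠ[nhds y]
      fun z => fderiv ℝ (translationFamily E F G x ξ) (0, z) (1, 0) := by
    filter_upwards [target_mem_nhds x hx] with z hz
    exact (fderiv_translationFamily (F := F) x ξ hz).symm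
  rw [coordLieDeriv_congr hX Filter.EventuallyEq.rfl]
  refine coordLieDeriv_eq_zero_of_pullback (differentiableAt_chartRep Ω x hx)
    ((contDiffAt_translationFamily (F := F) x ξ hx).of_le ENat.LEInfty.out) ?_ ?_ v
  · filter_upwards [target_mem_nhds x hx] with z hz
    simp only [translationFamily]
    rw [zero_smul, add_zero, extChartAt_to_inv, one_smul, (extChartAt 𝓘(ℝ, E) x).right_inv hz]
  · have hc : ContinuousAt (fun t : ℝ => (extChartAt 𝓘(ℝ, F) (1 : G)).symm (a + t • ξ) •
        (extChartAt 𝓘(ℝ, E) x).symm y) 0 := by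
      have h1 : ContinuousAt (extChartAt 𝓘(ℝ, F) (1 : G)).symm (a + (0 : ℝ) • ξ) := by
        rw [zero_smul, add_zero]
        exact (mdifferentiableAt_symm (1 : G) (mem_extChartAt_target (1 : G))).continuousAt
      have h2 : Continuous (fun t : ℝ => a + t • ξ) := by fun_prop
      exact ContinuousAt.comp (g := fun g : G => g • (extChartAt 𝓘(ℝ, E) x).symm y)
        (contMDiff_orbit E F _).continuous.continuousAt
        (ContinuousAt.comp (g := (extChartAt 𝓘(ℝ, F) (1 : G)).symm) h1 h2.continuousAt)
    have hsrc : ∀ᶠ t in nhds (0 : ℝ), (extChartAt 𝓘(ℝ, F) (1 : G)).symm (a + t • ξ) •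
        (extChartAt 𝓘(ℝ, E) x).symm y ∈ (extChartAt 𝓘(ℝ, E) x).source := by
      refine hc.eventually ((isOpen_extChartAt_source x).mem_nhds ?_)
      change (extChartAt 𝓘(ℝ, F) (1 : G)).symm (a + (0 : ℝ) • ξ) •
        (extChartAt 𝓘(ℝ, E) x).symm y ∈ _
      rw [zero_smul, add_zero, extChartAt_to_inv, one_smul, extChartAt_to_inv]
      exact mem_extChartAt_source x
    -- For small `t` the translated point stays in the chart at `x`, where the pullback of the
    -- representative under the family is the representative of `Φ_g^* Ω`.
    filter_upwards [hsrc] with t ht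
    ext w
    set g := (extChartAt 𝓘(ℝ, F) (1 : G)).symm (a + t • ξ) with hg
    refine Eq.trans ?_ (DFunLike.congr_fun (hG g ((extChartAt 𝓘(ℝ, E) x).symm y)) _)
    refine Eq.trans ?_ (chartRep_chart Ω.1 x ht _)
    refine congrArg (chartRep x Ω.1 (extChartAt 𝓘(ℝ, E) x
      (g • (extChartAt 𝓘(ℝ, E) x).symm y))) (funext fun i => ?_)
    exact fderiv_chart_expression (contMDiff_translation (contMDiff_action E M F G) g) x x hx ht
      (w i)

end Invariance

/-! ### Forms of all degrees at once -/

section TotalForms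
variable {E : Type*} [NormedAddCommGroup E] [NormedSpace ℝ E]
  {M : Type*} [TopologicalSpace M] [ChartedSpace E M] [IsManifold 𝓘(ℝ, E) ∞ M]

variable (E M) in
/-- Families of forms, one of each degree. -/
abbrev TotalForm := ∀ k : ℕ, DiffForm E M k

/-- The interior product on families of forms. -/
def totalInterior : VField E M →ₗ[ℝ] Module.End ℝ (TotalForm E M) :=
  LinearMap.mk₂ ℝ (fun X a k => interior k X (a (k + 1)))
    (fun X Y a => funext fun k => by rw [map_add, LinearMap.add_apply]; rfl)
    (fun c X a => funext fun k => by rw [map_smul, LinearMap.smul_apply]; rfl)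
    (fun X a b => funext fun k => map_add (interior k X) (a (k + 1)) (b (k + 1)))
    (fun c X a => funext fun k => map_smul (interior k X) c (a (k + 1)))

variable (E M) in
/-- The exterior derivative on families of forms. -/
def totalExtDer : Module.End ℝ (TotalForm E M) :=
  LinearMap.pi fun k => match k with
    | 0 => 0
    | k + 1 => extDer k ∘ₗ LinearMap.proj k

theorem totalExtDer_apply_succ (a : TotalForm E M) (k : ℕ) :
    totalExtDer E M a (k + 1) = extDer k (a k) := rfl

/-- The Lie derivative on families of forms. -/
def totalLieDer (X : VField E M) : Module.End ℝ (TotalForm E M) :=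
  LinearMap.pi fun k => lieDer k X ∘ₗ LinearMap.proj k

theorem totalLieDer_apply (X : VField E M) (a : TotalForm E M) (k : ℕ) :
    totalLieDer X a k = lieDer k X (a k) := rfl

/-- Cartan's formula in one shape for all degrees: in degree `0` the component of `totalExtDer` is
`0`, which accounts for the missing term in `lieDer 0`. -/
theorem totalLieDer_eq (X : VField E M) (a : TotalForm E M) :
    totalLieDer X a = totalExtDer E M (totalInterior X a) +
      totalInterior X (totalExtDer E M a) := by
  funext k
  cases k with
  | zero => exact (zero_add (interior 0 X (extDer 0 (a 0)))).symm
  | succ k => rfl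

theorem totalInterior_mul_self (X : VField E M) :
    totalInterior X * totalInterior X = (0 : Module.End ℝ (TotalForm E M)) :=
  LinearMap.ext fun a => funext fun k => interior_interior_self X (a (k + 2))

theorem totalExtDer_single {k : ℕ} {Ω : DiffForm E M k} (h : extDer k Ω = 0) :
    totalExtDer E M (Pi.single k Ω) = 0 := by
  funext l
  cases l with
  | zero => rfl
  | succ l =>
    rw [totalExtDer_apply_succ]
    by_cases hl : l = k
    · subst hl
      rw [Pi.single_eq_same, h]
      rfl
    · rw [Pi.single_eq_of_ne hl, map_zero]
      rfl

theorem totalLieDer_single {k : ℕ} {Ω : DiffForm E M k} {X : VField E M}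
    (h : lieDer k X Ω = 0) : totalLieDer X (Pi.single k Ω) = 0 := by
  funext l
  rw [totalLieDer_apply]
  by_cases hl : l = k
  · subst hl
    rw [Pi.single_eq_same, h]
    rfl
  · rw [Pi.single_eq_of_ne hl, map_zero]
    rfl

end TotalForms

/-! ### Contraction with the exterior algebra and the Chevalley–Eilenberg differential -/

section Contraction
variable {E : Type*} [NormedAddCommGroup E] [NormedSpace ℝ E]
  {M : Type*} [TopologicalSpace M] [ChartedSpace E M] [IsManifold 𝓘(ℝ, E) ∞ M]
  {F : Type*} [NormedAddCommGroup F] [NormedSpace ℝ F]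
  {G : Type*} [TopologicalSpace G] [ChartedSpace F G] [Group G] [LieGroup 𝓘(ℝ, F) ∞ G]
  [MulAction G M] [ContMDiffSMul 𝓘(ℝ, F) 𝓘(ℝ, E) ∞ G M]

variable (E M F G) in
/-- The action of the exterior algebra of the Lie algebra on families of forms in which `ξ` acts by
the interior product with `V_ξ`. -/
def genContraction :
    ExteriorAlgebra ℝ (GroupLieAlgebra 𝓘(ℝ, F) G) →ₐ[ℝ] Module.End ℝ (TotalForm E M) :=
  ExteriorAlgebra.lift ℝ ⟨totalInterior ∘ₗ infGen E M F G, fun ξ =>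
    totalInterior_mul_self (infGen E M F G ξ)⟩

theorem genContraction_ι_mul (ξ : GroupLieAlgebra 𝓘(ℝ, F) G)
    (x : ExteriorAlgebra ℝ (GroupLieAlgebra 𝓘(ℝ, F) G)) (a : TotalForm E M) :
    genContraction E M F G (ExteriorAlgebra.ι ℝ ξ * x) a =
      totalInterior (infGen E M F G ξ) (genContraction E M F G x a) := by
  rw [map_mul, genContraction, ExteriorAlgebra.lift_ι_apply]
  rfl

theorem genContraction_algebraMap (r : ℝ) (a : TotalForm E M) :
    genContraction E M F G (algebraMap ℝ _ r) a = r • a := by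
  rw [AlgHom.commutes]
  rfl

variable [CompleteSpace F]

theorem totalLieDer_totalInterior (ξ η : GroupLieAlgebra 𝓘(ℝ, F) G) (a : TotalForm E M) :
    totalLieDer (infGen E M F G ξ) (totalInterior (infGen E M F G η) a) =
      totalInterior (infGen E M F G η) (totalLieDer (infGen E M F G ξ) a) -
        totalInterior (infGen E M F G ⁅ξ, η⁆) a := by
  funext k
  refine (lieDer_interior (a (k + 1)) fun x => lieBracket_chartField_infGen x ξ η).trans ?_
  rw [map_neg, map_neg, LinearMap.neg_apply, ← sub_eq_add_neg]
  rfl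

/-- Induction on the number of factors: commuting `L_{V_ξ}` past each interior product replaces one
factor `η` by `-⁅ξ, η⁆`, and these corrections add up to `-ad_ξ x`. -/
theorem totalLieDer_genContraction (ξ : GroupLieAlgebra 𝓘(ℝ, F) G)
    (x : ExteriorAlgebra ℝ (GroupLieAlgebra 𝓘(ℝ, F) G)) (a : TotalForm E M) :
    totalLieDer (infGen E M F G ξ) (genContraction E M F G x a) =
      genContraction E M F G x (totalLieDer (infGen E M F G ξ) a) -
        genContraction E M F G (adExt ξ x) a := by
  induction x using exteriorAlgebra_left_induction with
  | algebraMap r =>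
    rw [adExt_algebraMap, map_zero, LinearMap.zero_apply, sub_zero, genContraction_algebraMap,
      genContraction_algebraMap, map_smul]
  | add x y hx hy =>
    simp only [map_add, LinearMap.add_apply, hx, hy]
    abel
  | ι_mul x η hx =>
    rw [genContraction_ι_mul, totalLieDer_totalInterior, hx, adExt_ι_mul, map_add,
      LinearMap.add_apply, genContraction_ι_mul, genContraction_ι_mul, genContraction_ι_mul,
      map_sub]
    abel

/-- On closed invariant forms, the exterior derivative corresponds to the Chevalley–Eilenberg
differential. -/
theorem totalExtDer_genContraction {a : TotalForm E M} (hd : totalExtDer E M a = 0)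
    (hL : ∀ ξ : GroupLieAlgebra 𝓘(ℝ, F) G, totalLieDer (infGen E M F G ξ) a = 0)
    (x : ExteriorAlgebra ℝ (GroupLieAlgebra 𝓘(ℝ, F) G)) :
    totalExtDer E M (genContraction E M F G x a) = genContraction E M F G (ceDiff x) a := by
  induction x using exteriorAlgebra_left_induction with
  | algebraMap r =>
    rw [ceDiff_algebraMap, map_zero, LinearMap.zero_apply, genContraction_algebraMap, map_smul, hd,
      smul_zero]
  | add x y hx hy => simp only [map_add, LinearMap.add_apply, hx, hy]
  | ι_mul x η hx =>
    -- Cartan's formula solved for `d(V_η ⌟ ·)`: with invariance and the induction hypothesis it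
    -- becomes the recursion `ceDiff_ι_mul`.
    have h := totalLieDer_eq (infGen E M F G η) (genContraction E M F G x a)
    rw [totalLieDer_genContraction, hL, map_zero, zero_sub, hx] at h
    rw [genContraction_ι_mul, ceDiff_ι_mul, map_sub, LinearMap.sub_apply, map_neg,
      LinearMap.neg_apply, genContraction_ι_mul, eq_sub_of_add_eq h.symm]
    abel

/-- For `p` in the Lie kernel, `(ad_ξ p) ⌟ Ω` is exact. -/
theorem genContraction_adExt {a : TotalForm E M} (hd : totalExtDer E M a = 0)
    (hL : ∀ ξ : GroupLieAlgebra 𝓘(ℝ, F) G, totalLieDer (infGen E M F G ξ) a = 0)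
    (ξ : GroupLieAlgebra 𝓘(ℝ, F) G) {x : ExteriorAlgebra ℝ (GroupLieAlgebra 𝓘(ℝ, F) G)}
    (hx : ceDiff x = 0) :
    genContraction E M F G (adExt ξ x) a =
      totalExtDer E M (-totalInterior (infGen E M F G ξ) (genContraction E M F G x a)) := by
  -- By invariance the left side is minus the contraction with `ad_ξ x`; the term `V_ξ ⌟ d(·)`
  -- vanishes since `∂x = 0`.
  have h := totalLieDer_eq (infGen E M F G ξ) (genContraction E M F G x a)
  rw [totalLieDer_genContraction, hL, map_zero, zero_sub, totalExtDer_genContraction hd hL, hx,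
    map_zero, LinearMap.zero_apply, map_zero, add_zero] at h
  rw [map_neg, ← h, neg_neg]

end Contraction

/-! ### Comparison with the contraction by multivectors -/

section Components
variable {E : Type*} [NormedAddCommGroup E] [NormedSpace ℝ E]
  {M : Type*} [TopologicalSpace M] [ChartedSpace E M] [IsManifold 𝓘(ℝ, E) ∞ M]
  {F : Type*} [NormedAddCommGroup F] [NormedSpace ℝ F]
  {G : Type*} [TopologicalSpace G] [ChartedSpace F G] [Group G] [LieGroup 𝓘(ℝ, F) ∞ G]
  [MulAction G M] [ContMDiffSMul 𝓘(ℝ, F) 𝓘(ℝ, E) ∞ G M]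

/-- For `ξ₁ ∧ ⋯ ∧ ξₖ` the interior product with `V_{ξₖ}` acts first and takes the first slot of the
form, so the vectors appear in reverse order. -/
theorem genContraction_ιMulti_apply (k : ℕ) {l N : ℕ} (h : k + l = N)
    (v : Fin k → GroupLieAlgebra 𝓘(ℝ, F) G) (a : TotalForm E M) (x : M) :
    (genContraction E M F G (ExteriorAlgebra.ιMulti ℝ k v) a l).1 x =
      contractVec h ((a N).1 x) (fun i => infGenAt E F G x (v i.rev)) := by
  induction k generalizing l with
  | zero =>
    obtain rfl : l = N := by omega
    rw [ExteriorAlgebra.ιMulti_zero_apply, map_one]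
    ext Y
    change (a l).1 x Y = (a l).1 x _
    congr 1
    ext j
    simp [Fin.append, Fin.addCases]
  | succ k ih =>
    rw [ExteriorAlgebra.ιMulti_succ_apply, genContraction_ι_mul]
    ext Y
    have h' : k + (l + 1) = N := by omega
    have h1 := congrArg (fun τ => τ (Matrix.vecCons (infGenAt E F G x (v 0)) Y))
      (ih h' (Matrix.vecTail v))
    refine Eq.trans h1 ?_
    change (a N).1 x _ = (a N).1 x _
    congr 1
    -- The outermost factor `v 0` fills the last of the contracted slots, just before `Y`.
    have hs : (fun i : Fin (k + 1) => infGenAt E F G x (v i.rev)) =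
        Fin.snoc (fun i : Fin k => infGenAt E F G x (Matrix.vecTail v i.rev))
          (infGenAt E F G x (v 0)) := by
      funext i
      refine Fin.lastCases ?_ (fun i => ?_) i
      · simp
      · simp [Matrix.vecTail, Fin.rev_castSucc]
    rw [hs, Fin.append_left_snoc]
    rfl

theorem contract_ιMulti {V : Type*} [AddCommGroup V] [Module ℝ V] [TopologicalSpace V]
    {k l N : ℕ} (h : k + l = N) (τ : V [⋀^Fin N]→L[ℝ] ℝ) (X : Fin k → V) :
    contract h τ (exteriorPower.ιMulti ℝ k X) = contractVec h τ X :=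
  exteriorPower.alternatingMapLinearEquiv_apply_ιMulti _ X

/-- The sign of the order reversing permutation of `k` elements. -/
def revSign (k : ℕ) : ℝ := ((Equiv.Perm.sign (Fin.revPerm : Equiv.Perm (Fin k)) : ℤˣ) : ℤ)

theorem revSign_mul_self (k : ℕ) : revSign k * revSign k = 1 := by
  rw [revSign, ← Int.cast_mul, ← Units.val_mul, Int.units_mul_self]
  simp

/-- Apply the linear map `contract h τ` to the antisymmetry of the wedge product. -/
theorem contractVec_rev {V : Type*} [AddCommGroup V] [Module ℝ V] [TopologicalSpace V]
    {k l N : ℕ} (h : k + l = N) (τ : V [⋀^Fin N]→L[ℝ] ℝ) (X : Fin k → V) :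
    contractVec h τ (fun i => X i.rev) = revSign k • contractVec h τ X := by
  have h1 := (exteriorPower.ιMulti ℝ k (M := V)).map_perm X Fin.revPerm
  have h2 := congrArg (contract h τ) h1
  rw [Units.smul_def, ← Int.cast_smul_eq_zsmul ℝ, map_smul, contract_ιMulti,
    contract_ιMulti] at h2
  exact h2

theorem genContraction_apply {k l N : ℕ} (h : k + l = N)
    (p : ⋀[ℝ]^k (GroupLieAlgebra 𝓘(ℝ, F) G)) (a : TotalForm E M) (x : M) :
    (genContraction E M F G p a l).1 x =
      revSign k • contract h ((a N).1 x) (genMultivector p x) := by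
  have hp : p ∈ Submodule.span ℝ (Set.range (exteriorPower.ιMulti ℝ k)) := by
    rw [exteriorPower.ιMulti_span]
    trivial
  induction hp using Submodule.span_induction with
  | mem p h' =>
    obtain ⟨v, rfl⟩ := h'
    rw [genMultivector, exteriorPower.map_apply_ιMulti, contract_ιMulti, ← contractVec_rev]
    exact genContraction_ιMulti_apply k h v a x
  | zero =>
    rw [genMultivector, map_zero, map_zero, smul_zero, Submodule.coe_zero, map_zero]
    rfl
  | add p q _ _ hp hq =>
    rw [genMultivector] at *
    rw [map_add, map_add, smul_add, ← hp, ← hq, Submodule.coe_add, map_add]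
    rfl
  | smul c p _ hp =>
    rw [genMultivector] at *
    rw [map_smul, map_smul, smul_comm, ← hp, Submodule.coe_smul, map_smul]
    rfl

end Components

/-! ### Smoothness of the multivector fields of the action -/

section Smoothness

/-- In a finite basis the value is a polynomial in the coordinates of the arguments. Needed because
the functionals testing smoothness of a multivector field are purely algebraic. -/
theorem contDiffOn_multilinear {D E ι : Type*} [NormedAddCommGroup D] [NormedSpace ℝ D]
    [NormedAddCommGroup E] [NormedSpace ℝ E] [FiniteDimensional ℝ E] [Fintype ι]
    (A : MultilinearMap ℝ (fun _ : ι => E) ℝ) {w : ι → D → E} {s : Set D}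
    (hw : ∀ i, ContDiffOn ℝ ∞ (w i) s) : ContDiffOn ℝ ∞ (fun y => A (fun i => w i y)) s := by
  classical
  let b := Module.finBasis ℝ E
  have h (y : D) : A (fun i => w i y) =
      ∑ r : ι → Fin (Module.finrank ℝ E), (∏ i, b.coord (r i) (w i y)) * A (fun i => b (r i)) := by
    conv_lhs => rw [show (fun i => w i y) = fun i => ∑ j, b.repr (w i y) j • b j from
      funext fun i => (b.sum_repr (w i y)).symm]
    rw [MultilinearMap.map_sum]
    refine Finset.sum_congr rfl fun r _ => ?_
    rw [MultilinearMap.map_smul_univ]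
    rfl
  simp only [h]
  refine ContDiffOn.sum fun r _ => ContDiffOn.mul (contDiffOn_prod fun i _ => ?_) contDiffOn_const
  exact (LinearMap.toContinuousLinearMap (b.coord (r i))).contDiff.comp_contDiffOn (hw i)

variable {E : Type*} [NormedAddCommGroup E] [NormedSpace ℝ E]
  {M : Type*} [TopologicalSpace M] [ChartedSpace E M] [IsManifold 𝓘(ℝ, E) ∞ M]
  {F : Type*} [NormedAddCommGroup F] [NormedSpace ℝ F]
  {G : Type*} [TopologicalSpace G] [ChartedSpace F G] [Group G] [LieGroup 𝓘(ℝ, F) ∞ G]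
  [MulAction G M] [ContMDiffSMul 𝓘(ℝ, F) 𝓘(ℝ, E) ∞ G M]

theorem isSmoothMultivectorField_genMultivector [FiniteDimensional ℝ E] {k : ℕ}
    (p : ⋀[ℝ]^k (GroupLieAlgebra 𝓘(ℝ, F) G)) :
    IsSmoothMultivectorField (fun x : M => genMultivector (E := E) p x) := by
  intro x₀ ℓ
  have hp : p ∈ Submodule.span ℝ (Set.range (exteriorPower.ιMulti ℝ k)) := by
    rw [exteriorPower.ιMulti_span]
    trivial
  induction hp using Submodule.span_induction with
  | mem p h' =>
    obtain ⟨v, rfl⟩ := h'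
    simp only [genMultivector, exteriorPower.map_apply_ιMulti]
    exact contDiffOn_multilinear
      (ℓ.compAlternatingMap (exteriorPower.ιMulti ℝ k (M := E))).toMultilinearMap
      (fun i => contDiffOn_vectorField (infGen E M F G (v i)) x₀)
  | zero =>
    simp only [genMultivector, map_zero]
    exact contDiffOn_const
  | add p q _ _ hp hq =>
    simp only [genMultivector, map_add] at hp hq ⊢
    exact hp.add hq
  | smul c p _ hp =>
    simp only [genMultivector, map_smul] at hp ⊢
    exact (contDiffOn_const (c := c)).smul hp

end Smoothness

/-! ### Consequences of the vanishing of `H⁰` -/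

section InvariantTheory
variable {L : Type*} [LieRing L] [LieAlgebra ℝ L]

/-- A proper subspace lies in the kernel of a nonzero functional; if the subspace contains every
`ad_ξ p`, that functional is invariant, against the hypothesis. -/
theorem eq_top_of_lieH0_coadKernel_eq_bot {k : ℕ}
    (h : lieH0 (coadKernel (L := L) k) = ⊥) {S : Submodule ℝ (lieKernel L k)}
    (hS : ∀ ξ p, adKernel k ξ p ∈ S) : S = ⊤ := by
  by_contra hne
  obtain ⟨c, hc, hle⟩ :=
    @Submodule.exists_le_ker_of_lt_top ℝ (lieKernel L k) _ _ _ S (Ne.lt_top hne)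
  refine hc ((Submodule.mem_bot ℝ).1 (h ▸ ?_))
  refine LinearMap.mem_ker.2 (LinearMap.ext fun ξ => LinearMap.ext fun p => ?_)
  change -c (adKernel k ξ p) = 0
  rw [LinearMap.mem_ker.1 (hle (hS ξ p)), neg_zero]

/-- A functional `φ` with `φ r ≠ 0` sends `r ⊗ s` to `φ r • s`. -/
theorem tmul_ne_zero {R S : Type*} [AddCommGroup R] [Module ℝ R] [AddCommGroup S] [Module ℝ S]
    {r : R} {s : S} (hr : r ≠ 0) (hs : s ≠ 0) : r ⊗ₜ[ℝ] s ≠ 0 := by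
  obtain ⟨φ, hφ⟩ : ∃ φ : Module.Dual ℝ R, φ r ≠ 0 := by
    by_contra! h
    exact hr ((Module.forall_dual_apply_eq_zero_iff ℝ r).1 h)
  intro h
  have h1 := congrArg (fun t => TensorProduct.lid ℝ S (LinearMap.rTensor S φ t)) h
  simp only [LinearMap.rTensor_tmul, TensorProduct.lid_tmul, map_zero] at h1
  exact smul_ne_zero hφ hs h1

/-- The tensor product of two invariants is invariant, and over a field it is nonzero when both
factors are. -/
theorem lieH0_eq_bot_of_tensor {R S : Type*} [AddCommGroup R] [Module ℝ R] [AddCommGroup S]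
    [Module ℝ S] (ρ : L →ₗ[ℝ] Module.End ℝ R) (σ : L →ₗ[ℝ] Module.End ℝ S)
    (h : lieH0 (tensorAction ρ σ) = ⊥) (hσ : lieH0 σ ≠ ⊥) : lieH0 ρ = ⊥ := by
  obtain ⟨s, hs, hs0⟩ := (Submodule.ne_bot_iff _).1 hσ
  by_contra hne
  obtain ⟨c, hc, hc0⟩ := (Submodule.ne_bot_iff _).1 hne
  refine tmul_ne_zero hc0 hs0 ((Submodule.mem_bot ℝ).1 (h ▸ ?_))
  refine LinearMap.mem_ker.2 (LinearMap.ext fun ξ => ?_)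
  have h1 : ρ ξ c = 0 := LinearMap.congr_fun (LinearMap.mem_ker.1 hc) ξ
  have h2 : σ ξ s = 0 := LinearMap.congr_fun (LinearMap.mem_ker.1 hs) ξ
  change ρ ξ c ⊗ₜ[ℝ] s + c ⊗ₜ[ℝ] σ ξ s = 0
  rw [h1, h2, TensorProduct.zero_tmul, TensorProduct.tmul_zero, add_zero]

theorem exists_section_range {A B : Type*} [AddCommGroup A] [Module ℝ A] [AddCommGroup B]
    [Module ℝ B] (f : A →ₗ[ℝ] B) :
    ∃ s : LinearMap.range f →ₗ[ℝ] A, ∀ b, f (s b) = (b : B) := by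
  obtain ⟨s, hs⟩ := f.rangeRestrict.exists_rightInverse_of_surjective
    (LinearMap.range_eq_top.2 f.surjective_rangeRestrict)
  exact ⟨s, fun b => congrArg Subtype.val (LinearMap.congr_fun hs b)⟩

end InvariantTheory

/-! ### Construction of the moment map -/

section Existence
variable {E : Type*} [NormedAddCommGroup E] [NormedSpace ℝ E] [FiniteDimensional ℝ E]
  {M : Type*} [TopologicalSpace M] [ChartedSpace E M] [IsManifold 𝓘(ℝ, E) ∞ M]
  {F : Type*} [NormedAddCommGroup F] [NormedSpace ℝ F] [FiniteDimensional ℝ F]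
  {G : Type*} [TopologicalSpace G] [ChartedSpace F G] [Group G] [LieGroup 𝓘(ℝ, F) ∞ G]
  [MulAction G M] [ContMDiffSMul 𝓘(ℝ, F) 𝓘(ℝ, E) ∞ G M]

variable (F G) in
/-- The component of degree `l` of the contraction of `a` with elements of the Lie kernel. -/
def kernelContraction (a : TotalForm E M) (k l : ℕ) :
    lieKernel (GroupLieAlgebra 𝓘(ℝ, F) G) k →ₗ[ℝ] DiffForm E M l :=
  LinearMap.proj l ∘ₗ (genContraction E M F G).toLinearMap.flip a ∘ₗ
    (⋀[ℝ]^k (GroupLieAlgebra 𝓘(ℝ, F) G)).subtype ∘ₗ (lieKernel _ k).subtype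

theorem exists_weakMomentComponent {n : ℕ} {Ω : DiffForm E M (n + 1)}
    (hΩ : extDer (n + 1) Ω = 0) (hG : PreservesForm G Ω) {k : ℕ} (hk : k ≤ n)
    (h : lieH0 (coadKernel (L := GroupLieAlgebra 𝓘(ℝ, F) G) k) = ⊥) :
    ∃ f : lieKernel (GroupLieAlgebra 𝓘(ℝ, F) G) k →ₗ[ℝ] DiffForm E M (n - k),
      IsWeakMomentComponent Ω k hk f := by
  have hN : k + (n - k + 1) = n + 1 := by omega
  let a : TotalForm E M := Pi.single (n + 1) Ω
  have hd : totalExtDer E M a = 0 := totalExtDer_single hΩ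
  have hL (ξ : GroupLieAlgebra 𝓘(ℝ, F) G) : totalLieDer (infGen E M F G ξ) a = 0 :=
    totalLieDer_single (lieDer_infGen_eq_zero (F := F) hG ξ)
  let Θ := kernelContraction F G a k (n - k + 1)
  have htop : (LinearMap.range (extDer (E := E) (M := M) (n - k))).comap Θ = ⊤ := by
    refine eq_top_of_lieH0_coadKernel_eq_bot h fun ξ p => ?_
    -- The primitive of `Θ (ad_ξ p)` is the component of degree `n - k` of the primitive in
    -- `genContraction_adExt`.
    refine ⟨(-totalInterior (infGen E M F G ξ)
      (genContraction E M F G (p : ExteriorAlgebra ℝ (GroupLieAlgebra 𝓘(ℝ, F) G)) a)) (n - k), ?_⟩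
    exact (congrFun (genContraction_adExt hd hL ξ p.2) (n - k + 1)).symm
  have hrange (p) : Θ p ∈ LinearMap.range (extDer (E := E) (M := M) (n - k)) := by
    have hp : p ∈ (LinearMap.range (extDer (E := E) (M := M) (n - k))).comap Θ := by
      rw [htop]
      trivial
    exact hp
  obtain ⟨s, hs⟩ := exists_section_range (extDer (E := E) (M := M) (n - k))
  let g := s ∘ₗ Θ.codRestrict _ hrange
  have hgΘ (p) : extDer (n - k) (g p) = Θ p := hs ⟨Θ p, hrange p⟩
  have hΘ (p : lieKernel (GroupLieAlgebra 𝓘(ℝ, F) G) k) (x : M) :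
      (Θ p).1 x = revSign k • contract hN (Ω.1 x) (genMultivector p.1 x) := by
    have := genContraction_apply hN p.1 a x
    rwa [show a (n + 1) = Ω from Pi.single_eq_same _ _] at this
  -- The factor `revSign k` undoes the reversed order in `Θ`, as its square is `1`; `-zetaSign k` is
  -- the sign required of a moment map.
  have hder (p : lieKernel (GroupLieAlgebra 𝓘(ℝ, F) G) k) (x : M) :
      (extDer (n - k) ((-(zetaSign k * revSign k) • g) p)).1 x =
        -(zetaSign k • contract hN (Ω.1 x) (genMultivector p.1 x)) := by
    rw [LinearMap.smul_apply, map_smul, hgΘ]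
    change -(zetaSign k * revSign k) • (Θ p).1 x = _
    rw [hΘ, smul_smul, neg_mul, mul_assoc, revSign_mul_self, mul_one]
    exact neg_smul (zetaSign k) (contract hN (Ω.1 x) (genMultivector p.1 x))
  -- The Hamiltonian multivector field of `f p` is `ζ(k) V_p`, the sign being absorbed in the
  -- argument `ζ(k) p`.
  refine ⟨-(zetaSign k * revSign k) • g, fun p => ⟨fun x => genMultivector (zetaSign k • p.1) x,
    isSmoothMultivectorField_genMultivector _, fun x => ?_⟩, hder⟩
  rw [hder p x]
  simp only [genMultivector, map_smul]

end Existence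

end Multisymplectic
end

open Multisymplectic
open scoped Manifold ContDiff
theorem mainTheorem1
    {E : Type*} [NormedAddCommGroup E] [NormedSpace ℝ E] [FiniteDimensional ℝ E]
    {M : Type*} [TopologicalSpace M] [T2Space M] [SecondCountableTopology M]
    [ChartedSpace E M] [IsManifold 𝓘(ℝ, E) ∞ M]
    {F : Type*} [NormedAddCommGroup F] [NormedSpace ℝ F] [FiniteDimensional ℝ F]
    {G : Type*} [TopologicalSpace G] [ConnectedSpace G] [ChartedSpace F G] [Group G]
    [LieGroup 𝓘(ℝ, F) ∞ G]
    [MulAction G M] [ContMDiffSMul 𝓘(ℝ, F) 𝓘(ℝ, E) ∞ G M]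
    (n : ℕ) (hn : 1 ≤ n) (Ω : DiffForm E M (n + 1)) (hΩ : IsPlectic Ω)
    (hG : PreservesForm G Ω) :
    (∀ (k : ℕ) (_ : 1 ≤ k) (hk : k ≤ n),
      lieH0 (coadKernel (L := GroupLieAlgebra 𝓘(ℝ, F) G) k) = ⊥ →
      ∃ f : lieKernel (GroupLieAlgebra 𝓘(ℝ, F) G) k →ₗ[ℝ] DiffForm E M (n - k),
        IsWeakMomentComponent Ω k hk f) ∧
    ((∀ k : ℕ, 1 ≤ k → k ≤ n →
      lieH0 (coadKernel (L := GroupLieAlgebra 𝓘(ℝ, F) G) k) = ⊥) →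
      ∃ f : ∀ k : ℕ, 1 ≤ k → k ≤ n →
          (lieKernel (GroupLieAlgebra 𝓘(ℝ, F) G) k →ₗ[ℝ] DiffForm E M (n - k)),
        IsWeakMomentMap Ω f) ∧
    (∀ (k : ℕ) (_ : 1 ≤ k) (hk : k ≤ n),
      lieH0 (tensorAction (coadKernel (L := GroupLieAlgebra 𝓘(ℝ, F) G) k)
        (closedFormAction E M F G (n - k))) = ⊥ →
      lieH0 (closedFormAction E M F G (n - k)) ≠ ⊥ →
      ∃ f : lieKernel (GroupLieAlgebra 𝓘(ℝ, F) G) k →ₗ[ℝ] DiffForm E M (n - k),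
        IsWeakMomentComponent Ω k hk f) ∧
    ((∀ k : ℕ, 1 ≤ k → k ≤ n →
      lieH0 (tensorAction (coadKernel (L := GroupLieAlgebra 𝓘(ℝ, F) G) k)
        (closedFormAction E M F G (n - k))) = ⊥ ∧
      lieH0 (closedFormAction E M F G (n - k)) ≠ ⊥) →
      ∃ f : ∀ k : ℕ, 1 ≤ k → k ≤ n →
          (lieKernel (GroupLieAlgebra 𝓘(ℝ, F) G) k →ₗ[ℝ] DiffForm E M (n - k)),
        IsWeakMomentMap Ω f) := by
  have key (k : ℕ) (hk : k ≤ n)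
      (h : lieH0 (coadKernel (L := GroupLieAlgebra 𝓘(ℝ, F) G) k) = ⊥) :
      ∃ f : lieKernel (GroupLieAlgebra 𝓘(ℝ, F) G) k →ₗ[ℝ] DiffForm E M (n - k),
        IsWeakMomentComponent Ω k hk f :=
    exists_weakMomentComponent hΩ.closed hG hk h
  refine ⟨fun k _ hk h => key k hk h, fun h => ?_,
    fun k _ hk h h' => key k hk (lieH0_eq_bot_of_tensor _ _ h h'), fun h => ?_⟩
  · choose f hf using fun k hk₁ hk => key k hk (h k hk₁ hk)
    exact ⟨f, hf⟩
  · choose f hf using fun k hk₁ hk =>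
      key k hk (lieH0_eq_bot_of_tensor _ _ (h k hk₁ hk).1 (h k hk₁ hk).2)
    exact ⟨f, hf⟩
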